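/- Let $m\ge 2$ and let $\bar M=SU_{2,m}/S(U_2U_m)$ be the complex hyperbolic two-plane Grassmannian. Write $\mathfrak{su}_{2,m}=\mathfrak k\oplus\mathfrak p$ for the Cartan decomposition and identify $T_o\bar M$ with $\mathfrak p=\left\{\begin{pmatrix}0&X\\ X^*&0\end{pmatrix}: X\in M_{2,m}(\mathbb C)\right\}$. Equip $\bar M$ with the $SU_{2,m}$-invariant Riemannian metric $g$ normalized so that its minimal sectional curvature is $-4$, that is, $g(X,Y)=\mathrm{Re}\,\mathrm{tr}(XY^*)$ on $\mathfrak p$; with the invariant Kähler structure $J$ given on $\mathfrak p$ by $X\mapsto iX$; and with the invariant quaternionic Kähler structure $\mathfrak J$ given on $\mathfrak p$ by the maps $X\mapsto qX$, $q\in\mathfrak{su}_2$. A canonical local basis of $\mathfrak J$ consists of almost Hermitian structures $J_1,J_2,J_3\in\mathfrak J$ with $J_\nu J_{\nu+1}=J_{\nu+2}=-J_{\nu+1}J_\nu$ (indices modulo $3$). Let $M$ be a connected orientable (immersed, smooth) real hypersurface of $\bar M$ with unit normal vector field $N$, induced metric $g$, Levi-Civita connection $\nabla$ of $(M,g)$,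 and shape operator $AX=-\bar\nabla_XN$, where $\bar\nabla$ is the Levi-Civita connection of $\bar M$. For $X$ tangent to $M$ write $JX=\phi X+\eta(X)N$ and $J_\nu X=\phi_\nu X+\eta_\nu(X)N$, with $\phi X$ and $\phi_\nu X$ tangent to $M$, and let $\xi=-JN$ be the Reeb vector field. Suppose that the Reeb flow is geodesic, that is, $\nabla_\xi\xi=0$. Then there is a smooth function $\alpha$ on $M$ with $A\xi=\alpha\xi$, and for every point $x\in M$, every canonical local basis $J_1,J_2,J_3$ of $\mathfrak J$ near the image of $x$ in $\bar M$, and all $X,Y\in T_xM$, $$ \begin{aligned} 2g(A\phi AX,Y)&-\alpha\, g((A\phi+\phi A)X,Y)+g(\phi X,Y)\\ &=\sum_{\nu=1}^3\big\{\eta_\nu(X)\eta_\nu(\phi Y)-\eta_\nu(Y)\eta_\nu(\phi X)-g(\phi_\nu X,Y)\eta_\nu(\xi)\\ &\qquad\quad-2\eta(X)\eta_\nu(\phi Y)\eta_\nu(\xi)+2\eta(Y)\eta_\nu(\phi X)\eta_\nu(\xi)\big\}. \end{aligned} $$ -/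

import Mathlib

open scoped Manifold ContDiff Matrix ComplexOrder

noncomputable section

namespace HyperbolicGrassmannian

/-! ### The homogeneous space `SU(2,m) / S(U(2)U(m))` -/

/-- The matrix `I_{2,m} = diag(-I₂, I_m)`. -/
def signature (m : ℕ) : Matrix (Fin 2 ⊕ Fin m) (Fin 2 ⊕ Fin m) ℂ :=
  Matrix.fromBlocks (-1) 0 0 1

/-- The indefinite special unitary group `SU(2,m)`. -/
def SU (m : ℕ) : Subgroup (Matrix.SpecialLinearGroup (Fin 2 ⊕ Fin m) ℂ) where
  carrier := {g | (g.1)ᴴ * signature m * g.1 = signature m}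
  one_mem' := by simp
  mul_mem' := by
    intro a b ha hb
    simp only [Set.mem_ofPred_eq] at ha hb ⊢
    calc ((a * b).1)ᴴ * signature m * (a * b).1
        = (b.1)ᴴ * ((a.1)ᴴ * signature m * a.1) * b.1 := by
          simp [Matrix.conjTranspose_mul, Matrix.mul_assoc]
      _ = signature m := by rw [ha, hb]
  inv_mem' := by
    intro a ha
    simp only [Set.mem_ofPred_eq] at ha ⊢
    have h : a.1 * (a⁻¹).1 = 1 := congrArg Subtype.val (mul_inv_cancel a)
    have h' : ((a⁻¹).1)ᴴ * (a.1)ᴴ = 1 := by rw [← Matrix.conjTranspose_mul, h]; simp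
    calc ((a⁻¹).1)ᴴ * signature m * (a⁻¹).1
        = ((a⁻¹).1)ᴴ * ((a.1)ᴴ * signature m * a.1) * (a⁻¹).1 := by rw [ha]
      _ = (((a⁻¹).1)ᴴ * (a.1)ᴴ) * signature m * (a.1 * (a⁻¹).1) := by
          simp only [Matrix.mul_assoc]
      _ = signature m := by rw [h, h']; simp

/-- The four blocks of `g ∈ SU(2,m)`. -/
def blockA {m : ℕ} (g : SU m) : Matrix (Fin 2) (Fin 2) ℂ := g.1.1.toBlocks₁₁
def blockB {m : ℕ} (g : SU m) : Matrix (Fin 2) (Fin m) ℂ := g.1.1.toBlocks₁₂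
def blockC {m : ℕ} (g : SU m) : Matrix (Fin m) (Fin 2) ℂ := g.1.1.toBlocks₂₁
def blockD {m : ℕ} (g : SU m) : Matrix (Fin m) (Fin m) ℂ := g.1.1.toBlocks₂₂

lemma coe_eq_fromBlocks {m : ℕ} (g : SU m) :
    g.1.1 = Matrix.fromBlocks (blockA g) (blockB g) (blockC g) (blockD g) :=
  (Matrix.fromBlocks_toBlocks _).symm

lemma blocks_mul {m : ℕ} (g h : SU m) :
    blockA (g * h) = blockA g * blockA h + blockB g * blockC h ∧
    blockB (g * h) = blockA g * blockB h + blockB g * blockD h ∧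
    blockC (g * h) = blockC g * blockA h + blockD g * blockC h ∧
    blockD (g * h) = blockC g * blockB h + blockD g * blockD h := by
  have h1 : (g * h).1.1 = g.1.1 * h.1.1 := rfl
  rw [coe_eq_fromBlocks, coe_eq_fromBlocks g, coe_eq_fromBlocks h,
    Matrix.fromBlocks_multiply, Matrix.fromBlocks_inj] at h1
  exact h1

lemma blocks_unitary {m : ℕ} (g : SU m) :
    (blockA g)ᴴ * blockA g = 1 + (blockC g)ᴴ * blockC g ∧
    (blockA g)ᴴ * blockB g = (blockC g)ᴴ * blockD g ∧
    (blockD g)ᴴ * blockD g = 1 + (blockB g)ᴴ * blockB g := by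
  have h := g.2
  change (g.1.1)ᴴ * signature m * g.1.1 = signature m at h
  rw [coe_eq_fromBlocks g, signature, Matrix.fromBlocks_conjTranspose,
    Matrix.fromBlocks_multiply, Matrix.fromBlocks_multiply, Matrix.fromBlocks_inj] at h
  obtain ⟨h1, h2, _, h4⟩ := h
  simp only [Matrix.mul_neg, Matrix.mul_one, Matrix.mul_zero, add_zero, zero_add,
    Matrix.neg_mul] at h1 h2 h4
  refine ⟨?_, ?_, ?_⟩
  · rw [neg_add_eq_iff_eq_add] at h1
    rw [h1]; abel_nf
  · exact (neg_add_eq_zero.mp h2)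
  · rw [neg_add_eq_iff_eq_add] at h4
    rw [h4, add_comm]

lemma isUnit_blockD {m : ℕ} (g : SU m) : IsUnit (blockD g) := by
  have h : ((1 : Matrix (Fin m) (Fin m) ℂ) + (blockB g)ᴴ * blockB g).PosDef :=
    Matrix.PosDef.one.add_posSemidef (Matrix.posSemidef_conjTranspose_mul_self _)
  rw [← (blocks_unitary g).2.2] at h
  have h' := (Matrix.isUnit_iff_isUnit_det _).1 h.isUnit
  rw [Matrix.det_mul] at h'
  exact (Matrix.isUnit_iff_isUnit_det _).2 (isUnit_of_mul_isUnit_right h')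

lemma isUnit_blockA {m : ℕ} (g : SU m) : IsUnit (blockA g) := by
  have h : ((1 : Matrix (Fin 2) (Fin 2) ℂ) + (blockC g)ᴴ * blockC g).PosDef :=
    Matrix.PosDef.one.add_posSemidef (Matrix.posSemidef_conjTranspose_mul_self _)
  rw [← (blocks_unitary g).1] at h
  have h' := (Matrix.isUnit_iff_isUnit_det _).1 h.isUnit
  rw [Matrix.det_mul] at h'
  exact (Matrix.isUnit_iff_isUnit_det _).2 (isUnit_of_mul_isUnit_right h')

/-- The isotropy group `S(U(2)U(m))`: the block diagonal elements of `SU(2,m)` (their diagonal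
blocks are automatically unitary). -/
def isotropy (m : ℕ) : Subgroup (SU m) where
  carrier := {g | blockB g = 0 ∧ blockC g = 0}
  one_mem' := by
    constructor
    · ext i j; simp [blockB, Matrix.toBlocks₁₂]
    · ext i j; simp [blockC, Matrix.toBlocks₂₁]
  mul_mem' := by
    rintro a b ⟨ha, ha'⟩ ⟨hb, hb'⟩
    obtain ⟨_, h2, h3, _⟩ := blocks_mul a b
    exact ⟨by rw [h2, ha, hb]; simp, by rw [h3, ha', hb']; simp⟩
  inv_mem' := by
    rintro a ⟨ha, ha'⟩
    obtain ⟨_, h2, h3, _⟩ := blocks_mul a a⁻¹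
    rw [mul_inv_cancel] at h2 h3
    have e2 : blockB (1 : SU m) = 0 := by
      ext i j; simp [blockB, Matrix.toBlocks₁₂]
    have e3 : blockC (1 : SU m) = 0 := by
      ext i j; simp [blockC, Matrix.toBlocks₂₁]
    rw [ha, e2, Matrix.zero_mul, add_zero] at h2
    rw [ha', e3, Matrix.zero_mul, zero_add] at h3
    constructor
    · have := congrArg (fun X => (blockA a)⁻¹ * X) h2
      simpa [Matrix.nonsing_inv_mul_cancel_left _ _
        ((Matrix.isUnit_iff_isUnit_det _).1 (isUnit_blockA a))] using this.symm
    · have := congrArg (fun X => (blockD a)⁻¹ * X) h3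
      simpa [Matrix.nonsing_inv_mul_cancel_left _ _
        ((Matrix.isUnit_iff_isUnit_det _).1 (isUnit_blockD a))] using this.symm

/-- The complex hyperbolic two-plane Grassmannian `SU(2,m) / S(U(2)U(m))`. -/
abbrev Space (m : ℕ) : Type := SU m ⧸ isotropy m

/-- The coordinate space of complex `2 × m` matrices, as a real normed space. It is also `𝔭`, with
`X` standing for the matrix `(0, X; Xᴴ, 0) ∈ 𝔰𝔲(2,m)`. -/
abbrev Coord (m : ℕ) : Type := Fin 2 → Fin m → ℂ

/-- A coordinate vector as a matrix, and back. -/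
abbrev mat {m : ℕ} (W : Coord m) : Matrix (Fin 2) (Fin m) ℂ := Matrix.of W
abbrev vec {m : ℕ} (W : Matrix (Fin 2) (Fin m) ℂ) : Coord m := Matrix.of.symm W

/-- The global (Harish-Chandra) chart of the Grassmannian, `g K ↦ B D⁻¹`. Its image is the bounded
symmetric domain of all `W` with `1 - W Wᴴ` positive definite, an open set, and the graph of `W` is
the orthogonal complement of the definite two-plane `g (ℂ² ⊕ 0)`. All tangent spaces of the
Grassmannian are identified with `Coord m` through this chart. -/
def coord {m : ℕ} (p : Space m) : Coord m :=
  Quotient.liftOn' p (fun g => vec (blockB g * (blockD g)⁻¹)) (by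
    intro a b hab
    have hk : a⁻¹ * b ∈ isotropy m := QuotientGroup.leftRel_apply.1 hab
    obtain ⟨k, rfl⟩ : ∃ k, b = a * k := ⟨a⁻¹ * b, by simp⟩
    rw [inv_mul_cancel_left] at hk
    obtain ⟨_, h2, _, h4⟩ := blocks_mul a k
    have hu := (Matrix.isUnit_iff_isUnit_det _).1 (isUnit_blockD k)
    change vec (blockB a * (blockD a)⁻¹) = vec (blockB (a * k) * (blockD (a * k))⁻¹)
    rw [h2, h4, hk.1, Matrix.mul_zero, Matrix.mul_zero, zero_add, zero_add, Matrix.mul_inv_rev,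
      Matrix.mul_assoc, ← Matrix.mul_assoc (blockD k), Matrix.mul_nonsing_inv _ hu,
      Matrix.one_mul])

lemma coord_mk {m : ℕ} (g : SU m) : coord (g : Space m) = vec (blockB g * (blockD g)⁻¹) := rfl

/-- Left translation by `g`, read in the chart. -/
def moebius {m : ℕ} (g : SU m) (W : Coord m) : Coord m :=
  vec ((blockA g * mat W + blockB g) * (blockC g * mat W + blockD g)⁻¹)

lemma coord_smul {m : ℕ} (g : SU m) (p : Space m) : coord (g • p) = moebius g (coord p) := by
  induction p using QuotientGroup.induction_on with
  | H h =>
    change coord ((g * h : SU m) : Space m) = _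
    obtain ⟨_, h2, _, h4⟩ := blocks_mul g h
    have hu := (Matrix.isUnit_iff_isUnit_det _).1 (isUnit_blockD h)
    have e1 : blockA g * blockB h + blockB g * blockD h =
        (blockA g * (blockB h * (blockD h)⁻¹) + blockB g) * blockD h := by
      rw [Matrix.add_mul, Matrix.mul_assoc, Matrix.mul_assoc, Matrix.nonsing_inv_mul _ hu,
        Matrix.mul_one]
    have e2 : blockC g * blockB h + blockD g * blockD h =
        (blockC g * (blockB h * (blockD h)⁻¹) + blockD g) * blockD h := by
      rw [Matrix.add_mul, Matrix.mul_assoc, Matrix.mul_assoc, Matrix.nonsing_inv_mul _ hu,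
        Matrix.mul_one]
    rw [coord_mk, coord_mk, h2, h4, e1, e2, moebius, mat, vec, Equiv.apply_symm_apply,
      Matrix.mul_inv_rev, Matrix.mul_assoc,
      ← Matrix.mul_assoc (blockD h), Matrix.mul_nonsing_inv _ hu, Matrix.one_mul]

lemma coord_injective {m : ℕ} : Function.Injective (coord (m := m)) := by
  intro p q hpq
  induction p using QuotientGroup.induction_on with
  | H g =>
  induction q using QuotientGroup.induction_on with
  | H h =>
    have h1 : coord (g⁻¹ • (g : Space m)) = coord (g⁻¹ • (h : Space m)) := by
      rw [coord_smul, coord_smul, hpq]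
    change coord ((g⁻¹ * g : SU m) : Space m) = coord ((g⁻¹ * h : SU m) : Space m) at h1
    rw [QuotientGroup.eq]
    generalize g⁻¹ * h = k at h1 ⊢
    have hu := (Matrix.isUnit_iff_isUnit_det _).1 (isUnit_blockD k)
    have hB : blockB k = 0 := by
      rw [inv_mul_cancel, coord_mk, coord_mk] at h1
      have e2 : blockB (1 : SU m) = 0 := (isotropy m).one_mem.1
      rw [e2, Matrix.zero_mul] at h1
      have := congrArg (fun X => X * blockD k) (Matrix.of.symm.injective h1)
      simpa [Matrix.mul_assoc, Matrix.nonsing_inv_mul _ hu] using this.symm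
    refine ⟨hB, ?_⟩
    have h2 := (blocks_unitary k).2.1
    rw [hB, Matrix.mul_zero] at h2
    have := congrArg (fun X => X * (blockD k)⁻¹) h2
    have h3 : (blockC k)ᴴ = 0 := by
      simpa [Matrix.mul_assoc, Matrix.mul_nonsing_inv _ hu] using this.symm
    simpa using h3

/-- The differential at the base point `o` of left translation by `g`. -/
def translate {m : ℕ} (g : SU m) : Coord m →L[ℝ] Coord m := fderiv ℝ (moebius g) 0

lemma translate_apply {m : ℕ} (g : SU m) (X : Coord m) :
    translate g X =
      vec ((blockA g - blockB g * (blockD g)⁻¹ * blockC g) * mat X * (blockD g)⁻¹) := by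
  set L : Matrix (Fin 2) (Fin 2) ℂ := blockA g - blockB g * (blockD g)⁻¹ * blockC g with hL
  have hu := (Matrix.isUnit_iff_isUnit_det _).1 (isUnit_blockD g)
  let bil : Coord m →ₗ[ℝ] (Fin m → Fin m → ℂ) →ₗ[ℝ] Coord m :=
    LinearMap.mk₂ ℝ (fun X T => vec (L * mat X * Matrix.of T))
      (by intros; simp [mat, vec, ← Matrix.of_add_of, Matrix.mul_add, Matrix.add_mul]; rfl)
      (by intros; simp [mat, vec, ← Matrix.smul_of]; rfl)
      (by intros; simp [mat, vec, ← Matrix.of_add_of, Matrix.mul_add]; rfl)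
      (by intros; simp [mat, vec, ← Matrix.smul_of]; rfl)
  let bilc : Coord m →L[ℝ] (Fin m → Fin m → ℂ) →L[ℝ] Coord m :=
    LinearMap.toContinuousLinearMap
      ((LinearMap.toContinuousLinearMap (𝕜 := ℝ)
        (E := Fin m → Fin m → ℂ) (F' := Coord m)).toLinearMap ∘ₗ bil)
  have hbil : ∀ X T, bilc X T = vec (L * mat X * Matrix.of T) := fun X T => rfl
  have hcont : Continuous fun W : Coord m => blockC g * mat W + blockD g :=
    (continuous_const.matrix_mul (continuous_id (X := Coord m))).add continuous_const
  have h0 : (blockC g * mat (0 : Coord m) + blockD g).det ≠ 0 := by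
    simpa [mat] using hu.ne_zero
  let inv : Coord m → Fin m → Fin m → ℂ :=
    fun W => Matrix.of.symm (blockC g * mat W + blockD g)⁻¹
  have hdet : ContinuousAt inv 0 := by
    have : ContinuousAt (fun W : Coord m => (blockC g * mat W + blockD g)⁻¹) 0 := by
      simp only [Matrix.inv_def, Ring.inverse_eq_inv']
      exact (hcont.matrix_det.continuousAt.inv₀ h0).smul hcont.matrix_adjugate.continuousAt
    exact this
  have hinv0 : inv 0 = Matrix.of.symm (blockD g)⁻¹ := by simp [inv, mat]
  have hne : ∀ᶠ W : Coord m in nhds 0, IsUnit (blockC g * mat W + blockD g).det := by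
    filter_upwards [hcont.matrix_det.continuousAt.eventually_ne h0] with W hW
    exact isUnit_iff_ne_zero.2 hW
  have key : HasFDerivAt (moebius g) (bilc.flip (inv 0)) 0 := by
    rw [hasFDerivAt_iff_isLittleO_nhds_zero]
    have h1 : (fun W : Coord m => bilc W (inv W - inv 0)) =o[nhds 0] fun W => W := by
      have hb := bilc.isBoundedBilinearMap.isBigO_comp (l := nhds (0 : Coord m))
        (g := fun W => W) (h := fun W => inv W - inv 0)
      refine hb.trans_isLittleO ?_
      have hz : (fun W : Coord m => ‖inv W - inv 0‖) =o[nhds 0] fun _ => (1 : ℝ) := by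
        rw [Asymptotics.isLittleO_one_iff]
        have := (hdet.sub (continuousAt_const (y := inv 0))).norm
        simpa [ContinuousAt] using this
      have := (Asymptotics.isBigO_refl (fun W : Coord m => ‖W‖) (nhds 0)).mul_isLittleO hz
      simp only [mul_one] at this
      exact this.of_norm_right
    refine h1.congr' ?_ (Filter.Eventually.of_forall fun _ => rfl)
    filter_upwards [hne] with W hW
    have e : moebius g W = vec (blockB g * (blockD g)⁻¹) + bilc W (inv W) := by
      have h2 : L * mat W = (blockA g * mat W + blockB g)
          - blockB g * (blockD g)⁻¹ * (blockC g * mat W + blockD g) := by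
        rw [hL, Matrix.mul_add, Matrix.mul_assoc (blockB g) _ (blockD g),
          Matrix.nonsing_inv_mul _ hu, Matrix.mul_one, Matrix.sub_mul, Matrix.mul_assoc _ _ (mat W)]
        abel
      have h3 : (blockA g * mat W + blockB g) * (blockC g * mat W + blockD g)⁻¹ =
          blockB g * (blockD g)⁻¹ + L * mat W * (blockC g * mat W + blockD g)⁻¹ := by
        rw [h2, Matrix.sub_mul, Matrix.mul_assoc (blockB g * (blockD g)⁻¹),
          Matrix.mul_nonsing_inv _ hW, Matrix.mul_one]
        abel
      rw [moebius, h3]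
      rfl
    have e0 : moebius g 0 = vec (blockB g * (blockD g)⁻¹) := by simp [moebius, mat, vec]
    rw [zero_add, e, e0, ContinuousLinearMap.flip_apply, map_sub]
    abel
  rw [translate, key.fderiv, ContinuousLinearMap.flip_apply, hbil, hinv0,
    Equiv.apply_symm_apply]

lemma blockA_conjTranspose_mul {m : ℕ} (g : SU m) :
    (blockA g)ᴴ * (blockA g - blockB g * (blockD g)⁻¹ * blockC g) = 1 := by
  have hu := (Matrix.isUnit_iff_isUnit_det _).1 (isUnit_blockD g)
  obtain ⟨h1, h2, _⟩ := blocks_unitary g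
  rw [Matrix.mul_sub, h1, ← Matrix.mul_assoc, ← Matrix.mul_assoc, h2,
    Matrix.mul_assoc _ (blockD g), Matrix.mul_nonsing_inv _ hu, Matrix.mul_one]
  abel

lemma one_sub_coord_mul {m : ℕ} (g : SU m) :
    (1 - mat (coord (g : Space m)) * (mat (coord (g : Space m)))ᴴ)⁻¹ =
        blockA g * (blockA g)ᴴ ∧
    (1 - (mat (coord (g : Space m)))ᴴ * mat (coord (g : Space m)))⁻¹ =
        blockD g * (blockD g)ᴴ := by
  set A := blockA g with hA
  set B := blockB g with hB
  set C := blockC g with hC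
  set D := blockD g with hD
  have hu := (Matrix.isUnit_iff_isUnit_det _).1 (isUnit_blockD g)
  have ha := (Matrix.isUnit_iff_isUnit_det _).1 (isUnit_blockA g)
  obtain ⟨u1, u2, u3⟩ := blocks_unitary g
  have l1 := blockA_conjTranspose_mul g
  rw [← hD] at hu u2 u3 l1
  rw [← hA] at ha u1 u2 l1
  rw [← hB] at u2 u3 l1
  rw [← hC] at u1 u2 l1
  have l2 : A - B * D⁻¹ * C = (Aᴴ)⁻¹ := (Matrix.inv_eq_right_inv l1).symm
  have haH : IsUnit (Aᴴ).det := by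
    rw [Matrix.det_conjTranspose]; exact ha.star
  have huH : IsUnit (Dᴴ).det := by
    rw [Matrix.det_conjTranspose]; exact hu.star
  have hW : B * D⁻¹ = (Aᴴ)⁻¹ * Cᴴ := by
    rw [← Matrix.nonsing_inv_mul_cancel_left _ (B * D⁻¹) haH, ← Matrix.mul_assoc (Aᴴ), u2,
      Matrix.mul_assoc, Matrix.mul_nonsing_inv _ hu, Matrix.mul_one]
  have p1 : (1 - (B * D⁻¹) * (B * D⁻¹)ᴴ)⁻¹ = A * Aᴴ := by
    apply Matrix.inv_eq_right_inv
    have : (Aᴴ)⁻¹ * (Aᴴ * A - Cᴴ * C) * A⁻¹ = 1 - (B * D⁻¹) * (B * D⁻¹)ᴴ := by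
      rw [hW, Matrix.mul_sub, Matrix.sub_mul, ← Matrix.mul_assoc, Matrix.nonsing_inv_mul _ haH,
        Matrix.one_mul, Matrix.mul_nonsing_inv _ ha, Matrix.conjTranspose_mul,
        Matrix.conjTranspose_nonsing_inv, Matrix.conjTranspose_conjTranspose,
        Matrix.conjTranspose_conjTranspose]
      simp only [Matrix.mul_assoc]
    rw [← this, u1, add_sub_cancel_right, Matrix.mul_one, Matrix.mul_assoc,
      Matrix.nonsing_inv_mul_cancel_left _ _ ha, Matrix.nonsing_inv_mul _ haH]
  have p2 : (1 - (B * D⁻¹)ᴴ * (B * D⁻¹))⁻¹ = D * Dᴴ := by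
    apply Matrix.inv_eq_right_inv
    have : (Dᴴ)⁻¹ * (Dᴴ * D - Bᴴ * B) * D⁻¹ = 1 - (B * D⁻¹)ᴴ * (B * D⁻¹) := by
      rw [Matrix.mul_sub, Matrix.sub_mul, ← Matrix.mul_assoc, Matrix.nonsing_inv_mul _ huH,
        Matrix.one_mul, Matrix.mul_nonsing_inv _ hu, Matrix.conjTranspose_mul,
        Matrix.conjTranspose_nonsing_inv]
      simp only [Matrix.mul_assoc]
    rw [← this, u3, add_sub_cancel_right, Matrix.mul_one, Matrix.mul_assoc,
      Matrix.nonsing_inv_mul_cancel_left _ _ hu, Matrix.nonsing_inv_mul _ huH]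
  exact ⟨p1, p2⟩

open scoped MatrixOrder in
lemma exists_conj_eq_one {n : Type*} [Fintype n] [DecidableEq n] {P : Matrix n n ℂ}
    (hP : P.PosDef) : ∃ A : Matrix n n ℂ, IsUnit A.det ∧ Aᴴ * P * A = 1 := by
  obtain ⟨Y, hY⟩ := CStarAlgebra.nonneg_iff_eq_star_mul_self.mp hP.posSemidef.nonneg
  rw [Matrix.star_eq_conjTranspose] at hY
  have hu : IsUnit Y.det := by
    have h' := (Matrix.isUnit_iff_isUnit_det _).1 hP.isUnit
    rw [hY, Matrix.det_mul] at h'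
    exact isUnit_of_mul_isUnit_right h'
  have huH : IsUnit (Yᴴ).det := by
    rw [Matrix.det_conjTranspose]; exact hu.star
  refine ⟨Y⁻¹, by simpa using hu, ?_⟩
  rw [hY, Matrix.conjTranspose_nonsing_inv, Matrix.mul_assoc, Matrix.mul_assoc,
    Matrix.mul_nonsing_inv _ hu, Matrix.mul_one, Matrix.nonsing_inv_mul _ huH]

/-- The chart maps onto the bounded symmetric domain. -/
lemma range_coord {m : ℕ} :
    Set.range (coord (m := m)) = {W | (1 - mat W * (mat W)ᴴ).PosDef} := by
  ext W
  constructor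
  · rintro ⟨p, rfl⟩
    induction p using QuotientGroup.induction_on with
    | H g =>
      have hA : (blockA g * (blockA g)ᴴ).PosDef := by
        rw [(Matrix.posSemidef_self_mul_conjTranspose _).posDef_iff_isUnit]
        have ha := isUnit_blockA g
        exact ha.mul (by rw [← Matrix.star_eq_conjTranspose]; exact ha.star)
      have h := hA.inv
      rw [← (one_sub_coord_mul g).1] at h
      by_cases hu : IsUnit (1 - mat (coord (g : Space m)) * (mat (coord (g : Space m)))ᴴ).det
      · rwa [Matrix.nonsing_inv_nonsing_inv _ hu] at h
      · exact absurd hA.isUnit (by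
          rw [← (one_sub_coord_mul g).1, Matrix.nonsing_inv_apply_not_isUnit _ hu]
          exact not_isUnit_zero)
  · intro hW
    set V := mat W with hV
    change (1 - V * Vᴴ).PosDef at hW
    have hW' : (1 - Vᴴ * V).PosDef := by
      have h1 : (1 - Vᴴ * V).PosSemidef := by
        let _ : Invertible (1 : Matrix (Fin 2) (Fin 2) ℂ) := invertibleOne
        let _ : Invertible (1 : Matrix (Fin m) (Fin m) ℂ) := invertibleOne
        have e1 := Matrix.PosDef.fromBlocks₁₁ V (1 : Matrix (Fin m) (Fin m) ℂ)
          (Matrix.PosDef.one (n := Fin 2) (R := ℂ))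
        have e2 := Matrix.PosDef.fromBlocks₂₂ (1 : Matrix (Fin 2) (Fin 2) ℂ) V
          (Matrix.PosDef.one (n := Fin m) (R := ℂ))
        simp only [inv_one, Matrix.mul_one] at e1 e2
        exact e1.1 (e2.2 hW.posSemidef)
      rw [h1.posDef_iff_det_ne_zero, Matrix.det_one_sub_mul_comm]
      exact hW.posSemidef.posDef_iff_det_ne_zero.1 hW
    obtain ⟨A, -, hA⟩ := exists_conj_eq_one hW
    obtain ⟨D, hDu, hD⟩ := exists_conj_eq_one hW'
    set g₀ := Matrix.fromBlocks A (V * D) (Vᴴ * A) D with hg₀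
    have hs : g₀ᴴ * signature m * g₀ = signature m := by
      rw [hg₀, signature, Matrix.fromBlocks_conjTranspose, Matrix.fromBlocks_multiply,
        Matrix.fromBlocks_multiply, Matrix.fromBlocks_inj]
      simp only [Matrix.mul_neg, Matrix.mul_one, Matrix.mul_zero, add_zero, zero_add,
        Matrix.neg_mul, Matrix.conjTranspose_mul, Matrix.conjTranspose_conjTranspose]
      simp only [Matrix.mul_sub, Matrix.sub_mul, Matrix.mul_one] at hA hD
      simp only [Matrix.mul_assoc] at hA hD ⊢
      refine ⟨?_, by simp, by simp, ?_⟩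
      · rw [← hA]; abel
      · rw [← hD]; abel
    have hd : star g₀.det * g₀.det = 1 := by
      have h1 := congrArg Matrix.det hs
      have h2 : (signature m).det = 1 := by
        simp [signature, Matrix.det_neg]
      simpa [Matrix.det_mul, Matrix.det_conjTranspose, h2] using h1
    set d := g₀.det with hdd
    have hd0 : d ≠ 0 := right_ne_zero_of_mul_eq_one hd
    set u : Matrix (Fin 2) (Fin 2) ℂ := Matrix.diagonal ![d⁻¹, 1] with hu
    have huu : uᴴ * u = 1 := by
      rw [hu, Matrix.diagonal_conjTranspose, Matrix.diagonal_mul_diagonal, ← Matrix.diagonal_one]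
      congr 1
      funext i
      fin_cases i
      · simp only [Pi.star_apply, Fin.zero_eta, Matrix.cons_val_zero, star_inv₀, ← mul_inv, hd,
          inv_one]
      · simp
    set k := Matrix.fromBlocks u 0 0 (1 : Matrix (Fin m) (Fin m) ℂ) with hk
    have hks : kᴴ * signature m * k = signature m := by
      rw [hk, signature, Matrix.fromBlocks_conjTranspose, Matrix.fromBlocks_multiply,
        Matrix.fromBlocks_multiply]
      simp [huu]
    have hdet : (g₀ * k).det = 1 := by
      rw [Matrix.det_mul, ← hdd, hk, Matrix.det_fromBlocks_zero₂₁, hu, Matrix.det_diagonal]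
      simp [hd0]
    let g : SU m := ⟨⟨g₀ * k, hdet⟩, by
      change (g₀ * k)ᴴ * signature m * (g₀ * k) = signature m
      calc (g₀ * k)ᴴ * signature m * (g₀ * k) = kᴴ * (g₀ᴴ * signature m * g₀) * k := by
            simp only [Matrix.conjTranspose_mul, Matrix.mul_assoc]
        _ = signature m := by rw [hs, hks]⟩
    refine ⟨(g : Space m), ?_⟩
    have hg : g.1.1 = Matrix.fromBlocks (A * u) (V * D) (Vᴴ * A * u) D := by
      change g₀ * k = _
      rw [hg₀, hk, Matrix.fromBlocks_multiply]
      simp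
    rw [coord_mk, blockB, blockD, hg, Matrix.toBlocks_fromBlocks₁₂, Matrix.toBlocks_fromBlocks₂₂,
      Matrix.mul_assoc, Matrix.mul_nonsing_inv _ hDu, Matrix.mul_one]
    rfl

/-- The Riemannian metric in the chart. It is the `SU(2,m)`-invariant metric that is
`Re tr (X Yᴴ)` on `𝔭 = T_o` (see `metric_zero`, `metric_translate`), a constant multiple of the
Killing metric, normalized so that the minimal sectional curvature is `-4`. -/
def metric {m : ℕ} (W X Y : Coord m) : ℝ :=
  (((1 - mat W * (mat W)ᴴ)⁻¹ * mat X * (1 - (mat W)ᴴ * mat W)⁻¹ * (mat Y)ᴴ).trace).re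

lemma metric_zero {m : ℕ} (X Y : Coord m) : metric 0 X Y = ((mat X * (mat Y)ᴴ).trace).re := by
  simp [metric, mat]

lemma metric_translate {m : ℕ} (g : SU m) (X Y : Coord m) :
    metric (coord (g : Space m)) (translate g X) (translate g Y) = metric 0 X Y := by
  obtain ⟨p1, p2⟩ := one_sub_coord_mul g
  have l2 := (Matrix.inv_eq_right_inv (blockA_conjTranspose_mul g)).symm
  have hu := (Matrix.isUnit_iff_isUnit_det _).1 (isUnit_blockD g)
  have ha := (Matrix.isUnit_iff_isUnit_det _).1 (isUnit_blockA g)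
  rw [metric_zero, metric, p1, p2, translate_apply, translate_apply, l2]
  set A := blockA g
  set D := blockD g
  have haH : IsUnit (Aᴴ).det := by
    rw [Matrix.det_conjTranspose]; exact ha.star
  have huH : IsUnit (Dᴴ).det := by
    rw [Matrix.det_conjTranspose]; exact hu.star
  have hY : ((Aᴴ)⁻¹ * mat Y * D⁻¹)ᴴ = (Dᴴ)⁻¹ * (mat Y)ᴴ * A⁻¹ := by
    rw [Matrix.conjTranspose_mul, Matrix.conjTranspose_mul, Matrix.conjTranspose_nonsing_inv,
      Matrix.conjTranspose_nonsing_inv, Matrix.conjTranspose_conjTranspose, Matrix.mul_assoc]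
  simp only [mat, vec, Equiv.apply_symm_apply]
  simp only [mat] at hY
  rw [hY]
  have : A * Aᴴ * ((Aᴴ)⁻¹ * Matrix.of X * D⁻¹) * (D * Dᴴ) * ((Dᴴ)⁻¹ * (Matrix.of Y)ᴴ * A⁻¹) =
      A * (Matrix.of X * (Matrix.of Y)ᴴ) * A⁻¹ := by
    simp only [Matrix.mul_assoc]
    rw [Matrix.mul_nonsing_inv_cancel_left _ _ haH, Matrix.nonsing_inv_mul_cancel_left _ _ hu,
      Matrix.mul_nonsing_inv_cancel_left _ _ huH]
  rw [this, Matrix.trace_mul_comm, ← Matrix.mul_assoc, Matrix.nonsing_inv_mul _ ha,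
    Matrix.one_mul]

/-- The Kähler structure `J`, the same at every point of the chart. On `𝔭 = T_o` it is the adjoint
action of `diag (m i / (m + 2) I₂, -2 i / (m + 2) I_m)`, that is, multiplication by `i`. -/
def kaehler {m : ℕ} : Coord m →ₗ[ℝ] Coord m where
  toFun X := Complex.I • X
  map_add' := by intros; simp
  map_smul' := by intro c X; simp [smul_comm c Complex.I X]

/-- The Kähler structure is invariant under `SU(2,m)`. -/
lemma translate_kaehler {m : ℕ} (g : SU m) (X : Coord m) :
    translate g (kaehler X) = kaehler (translate g X) := by
  have h : mat (kaehler X) = Complex.I • mat X := rfl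
  rw [translate_apply, translate_apply, h, Matrix.mul_smul, Matrix.smul_mul]
  rfl

/-- The quaternionic Kähler structure `𝔍` at `p`: the endomorphisms of the tangent space at
`p = g o` that correspond under the translation by `g` to the adjoint action on `𝔭 = T_o` of an
element `diag (q, 0)`, `q ∈ 𝔰𝔲(2)`. -/
def quaternionic {m : ℕ} (p : Space m) : Set (Coord m →ₗ[ℝ] Coord m) :=
  {T | ∃ g : SU m, (g : Space m) = p ∧ ∃ q : Matrix (Fin 2) (Fin 2) ℂ, qᴴ = -q ∧ q.trace = 0 ∧
    ∀ X, T (translate g X) = translate g (vec (q * mat X))}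

/-- `J₁, J₂, J₃` (indices modulo 3) are the values at `p` of a canonical local basis of `𝔍`. -/
structure IsCanonicalBasis {m : ℕ} (p : Space m) (Jq : Fin 3 → Coord m →ₗ[ℝ] Coord m) : Prop where
  mem : ∀ ν, Jq ν ∈ quaternionic p
  sq : ∀ ν X, Jq ν (Jq ν X) = -X
  isometry : ∀ ν X Y, metric (coord p) (Jq ν X) (Jq ν Y) = metric (coord p) X Y
  mul : ∀ ν X, Jq ν (Jq (ν + 1) X) = Jq (ν + 2) X
  mul_rev : ∀ ν X, Jq (ν + 1) (Jq ν X) = -Jq (ν + 2) X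

/-- `V` is the Christoffel symbol `Γ_W(X, Y)` of the Levi-Civita connection of the metric in the
chart. -/
def IsChristoffel {m : ℕ} (W X Y V : Coord m) : Prop :=
  ∀ U, 2 * metric W V U =
    fderiv ℝ (fun W' => metric W' Y U) W X + fderiv ℝ (fun W' => metric W' X U) W Y
      - fderiv ℝ (fun W' => metric W' X Y) W U

/-- The Christoffel symbol `Γ_W(X, Y)`; it exists and is unique on the image of the chart, where the
metric is positive definite. -/
def christoffel {m : ℕ} (W X Y : Coord m) : Coord m := Classical.epsilon (IsChristoffel W X Y)

/-! ### Real hypersurfaces -/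

/-- A smooth immersed real hypersurface `M` of `SU(2,m) / S(U(2)U(m))`, with a global smooth unit
normal vector field `N`. The ambient space is diffeomorphic to an open subset of a vector space, so
such a field exists if and only if `M` is orientable. Tangent vectors of the ambient space are read
in the chart. -/
structure OrientedHypersurface (m : ℕ) (M : Type*) [TopologicalSpace M]
    [ChartedSpace (EuclideanSpace ℝ (Fin (4 * m - 1))) M] where
  toFun : M → Space m
  normal : M → Coord m
  smooth : ContMDiff (𝓡 (4 * m - 1)) 𝓘(ℝ, Coord m) ∞ fun x => coord (toFun x)
  immersion : ∀ x, Function.Injective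
    (mvfderiv (𝓡 (4 * m - 1)) (fun y => coord (toFun y)) x)
  smooth_normal : ContMDiff (𝓡 (4 * m - 1)) 𝓘(ℝ, Coord m) ∞ normal
  normal_unit : ∀ x, metric (coord (toFun x)) (normal x) (normal x) = 1
  normal_orthogonal : ∀ x X, metric (coord (toFun x))
    (mvfderiv (𝓡 (4 * m - 1)) (fun y => coord (toFun y)) x X) (normal x) = 0

namespace OrientedHypersurface

variable {m : ℕ} {M : Type*} [TopologicalSpace M]
  [ChartedSpace (EuclideanSpace ℝ (Fin (4 * m - 1))) M] (S : OrientedHypersurface m M)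

/-- The differential of the immersion. -/
def diff (x : M) : TangentSpace (𝓡 (4 * m - 1)) x →L[ℝ] Coord m :=
  mvfderiv (𝓡 (4 * m - 1)) (fun y => coord (S.toFun y)) x

/-- The ambient inner product at the point of `x`. -/
def ambient (x : M) (v w : Coord m) : ℝ := metric (coord (S.toFun x)) v w

/-- The induced Riemannian metric `g` on `M`. -/
def g (x : M) (X Y : TangentSpace (𝓡 (4 * m - 1)) x) : ℝ :=
  S.ambient x (S.diff x X) (S.diff x Y)

/-- The tangential component of an ambient vector, the tangent vector `X` of `M` with
`v = X + ⟨v, N⟩ N`. -/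
def tangential (x : M) (v : Coord m) : TangentSpace (𝓡 (4 * m - 1)) x :=
  Classical.epsilon fun X => v = S.diff x X + S.ambient x v (S.normal x) • S.normal x

/-- The ambient Levi-Civita derivative `∇̄_X V` of a vector field `V` along the hypersurface. -/
def ambientCov (V : M → Coord m) (x : M) (X : TangentSpace (𝓡 (4 * m - 1)) x) : Coord m :=
  mvfderiv (𝓡 (4 * m - 1)) V x X
    + christoffel (coord (S.toFun x)) (S.diff x X) (V x)

/-- The shape operator `A X = -∇̄_X N`. -/
def shape (x : M) (X : TangentSpace (𝓡 (4 * m - 1)) x) : TangentSpace (𝓡 (4 * m - 1)) x :=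
  S.tangential x (-S.ambientCov S.normal x X)

/-- For an endomorphism `T` of the ambient tangent space at `x` (such as `J` or `J_ν`), the
tangential component `φ X` in `T X = φ X + η(X) N`. -/
def phi (x : M) (T : Coord m →ₗ[ℝ] Coord m) (X : TangentSpace (𝓡 (4 * m - 1)) x) :
    TangentSpace (𝓡 (4 * m - 1)) x :=
  S.tangential x (T (S.diff x X))

/-- The normal component `η(X)` in `T X = φ X + η(X) N`. -/
def eta (x : M) (T : Coord m →ₗ[ℝ] Coord m) (X : TangentSpace (𝓡 (4 * m - 1)) x) : ℝ :=
  S.ambient x (T (S.diff x X)) (S.normal x)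

/-- The structure tensor `φ` and the one-form `η` that the Kähler structure `J` induces on `M`. -/
abbrev φ (x : M) (X : TangentSpace (𝓡 (4 * m - 1)) x) : TangentSpace (𝓡 (4 * m - 1)) x :=
  S.phi x kaehler X
abbrev η (x : M) (X : TangentSpace (𝓡 (4 * m - 1)) x) : ℝ := S.eta x kaehler X

/-- The Reeb vector field `ξ = -J N`. -/
def reeb (x : M) : TangentSpace (𝓡 (4 * m - 1)) x :=
  S.tangential x (-kaehler (S.normal x))

/-- The right-hand side of the Koszul formula for `2 g(∇_X Y, W)`, with `∇` the Levi-Civita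
connection of `(M, g)`. -/
def koszul (X Y W : Π x : M, TangentSpace (𝓡 (4 * m - 1)) x) (x : M) : ℝ :=
  mvfderiv (𝓡 (4 * m - 1)) (fun y => S.g y (Y y) (W y)) x (X x)
    + mvfderiv (𝓡 (4 * m - 1)) (fun y => S.g y (X y) (W y)) x (Y x)
    - mvfderiv (𝓡 (4 * m - 1)) (fun y => S.g y (X y) (Y y)) x (W x)
    + S.g x (VectorField.mlieBracket (𝓡 (4 * m - 1)) X Y x) (W x)
    - S.g x (VectorField.mlieBracket (𝓡 (4 * m - 1)) X W x) (Y x)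
    - S.g x (VectorField.mlieBracket (𝓡 (4 * m - 1)) Y W x) (X x)

variable [IsManifold (𝓡 (4 * m - 1)) ∞ M]

/-- `V = (∇_X Y)(x)` for the Levi-Civita connection `∇` of `(M, g)`, where `X` and `Y` are smooth
vector fields on `M`. -/
def IsLeviCivita (X Y : Π x : M, TangentSpace (𝓡 (4 * m - 1)) x) (x : M)
    (V : TangentSpace (𝓡 (4 * m - 1)) x) : Prop :=
  ∀ W : Π y : M, TangentSpace (𝓡 (4 * m - 1)) y,
    ContMDiffAt (𝓡 (4 * m - 1)) (𝓡 (4 * m - 1)).tangent ∞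
      (fun y => (⟨y, W y⟩ : TangentBundle (𝓡 (4 * m - 1)) M)) x →
    2 * S.g x V (W x) = S.koszul X Y W x

/-- The Reeb flow is geodesic: `∇_ξ ξ = 0`, that is, the integral curves of `ξ` are geodesics
of `(M, g)`. -/
def GeodesicReebFlow : Prop := ∀ x, S.IsLeviCivita S.reeb S.reeb x 0

end OrientedHypersurface

end HyperbolicGrassmannian
end

/-! The whole computation takes place in the Harish-Chandra chart. With `P = (1 - W Wᴴ)⁻¹`, `Q = (1
- Wᴴ W)⁻¹` and `K = Wᴴ P`, the metric is the real part of the Hermitian form `h(X, Y) = tr(P X Q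
Yᴴ)`. The complex bilinear symmetric symbol `gam`, `X K Y + Y K X`, makes `h` parallel
(`hasDerivAt_form`), so it is the Levi-Civita connection (`christoffel_eq_gam`) and `J` is parallel
(`cov_smul`). Its curvature is `curv` (`cov_cov_sub`).

Let `∇_ξ ξ = 0`. The Koszul formula for `g(∇_ξ ξ, W)` reduces to the orthogonality of `∇̄_ξ N` and
`J(TM)` (`metric_kaehler_ambientCov_reeb`), so `∇̄_ξ N = α JN`, that is, `A ξ = α ξ`.
Self-adjointness of `A` turns this into an identity of one-forms, `g(A X, ξ) = α η(X)`. Its exterior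
derivative (`exterior_derivative`) relates `A φ A`, `α (A φ + φ A)`, `dα` and the curvature term
`g(R(X, Y) N, JN)`. Putting `X = ξ` expresses `dα` through `(ξ α) η` and the curvature. When this is
substituted back, the unknown `ξ α` drops out by antisymmetry (`exterior_derivative_eq`).

It remains to identify the curvature terms with the sum over `J₁, J₂, J₃`. All of them are traces of
products of two `2 × 2` matrices (`quartic`). The `J_ν` are left multiplications by traceless
matrices `q_ν` satisfying the quaternion relations, and the Fierz identity `sum_trace_mul_trace`
gives `∑ h(J_ν X, Y) h(J_ν Z, V) = h(X, Y) h(Z, V) - 2 quartic(X, Y, Z, V)`. Four instances of it,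
combined in `sum_canonicalBasis`, yield the right-hand side; the products `h h` leave the term `g(φ
X, Y)`. -/

noncomputable section

namespace HyperbolicGrassmannian

/-! ### Entrywise calculus of matrix-valued functions -/

section MatrixCalculus

variable {a b c : Type*} {E : Type*} [NormedAddCommGroup E] [NormedSpace ℝ E]

/-- Entrywise smoothness of a matrix-valued function. -/
def MatContDiffAt (n : WithTop ℕ∞) (F : E → Matrix a b ℂ) (u : E) : Prop :=
  ∀ i j, ContDiffAt ℝ n (fun v => F v i j) u

/-- Entrywise derivative of a matrix-valued curve. -/
def MatHasDerivAt (F : ℝ → Matrix a b ℂ) (F' : Matrix a b ℂ) (t : ℝ) : Prop :=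
  ∀ i j, HasDerivAt (fun s => F s i j) (F' i j) t

variable {n : WithTop ℕ∞} {u : E} {t : ℝ}

lemma MatContDiffAt.add {F G : E → Matrix a b ℂ} (hF : MatContDiffAt n F u)
    (hG : MatContDiffAt n G u) : MatContDiffAt n (fun v => F v + G v) u :=
  fun i j => (hF i j).add (hG i j)

lemma MatContDiffAt.sub {F G : E → Matrix a b ℂ} (hF : MatContDiffAt n F u)
    (hG : MatContDiffAt n G u) : MatContDiffAt n (fun v => F v - G v) u :=
  fun i j => (hF i j).sub (hG i j)

lemma MatContDiffAt.mul [Fintype b] {F : E → Matrix a b ℂ} {G : E → Matrix b c ℂ}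
    (hF : MatContDiffAt n F u) (hG : MatContDiffAt n G u) :
    MatContDiffAt n (fun v => F v * G v) u := fun i j => by
  simp only [Matrix.mul_apply]
  exact ContDiffAt.sum fun k _ => (hF i k).mul (hG k j)

lemma MatContDiffAt.conjTranspose {F : E → Matrix a b ℂ} (hF : MatContDiffAt n F u) :
    MatContDiffAt n (fun v => (F v)ᴴ) u := fun i j =>
  Complex.conjCLE.contDiff.contDiffAt.comp u (hF j i)

lemma MatContDiffAt.const (C : Matrix a b ℂ) : MatContDiffAt n (fun _ : E => C) u :=
  fun _ _ => contDiffAt_const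

lemma MatContDiffAt.trace [Fintype a] {F : E → Matrix a a ℂ} (hF : MatContDiffAt n F u) :
    ContDiffAt ℝ n (fun v => (F v).trace) u := by
  simp only [Matrix.trace, Matrix.diag_apply]
  exact ContDiffAt.sum fun i _ => hF i i

/-- The adjugate formula is explicit in size two. This size suffices: the `m × m` inverse is later
reduced to the `2 × 2` one by `Regular.rightWeight_eq`. -/
lemma MatContDiffAt.inv {F : E → Matrix (Fin 2) (Fin 2) ℂ} (hF : MatContDiffAt n F u)
    (hu : IsUnit (F u).det) : MatContDiffAt n (fun v => (F v)⁻¹) u := by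
  have hd : ContDiffAt ℝ n (fun v => (F v).det) u := by
    simp only [Matrix.det_fin_two]
    exact ((hF 0 0).mul (hF 1 1)).sub ((hF 0 1).mul (hF 1 0))
  have hd' : ContDiffAt ℝ n (fun v => ((F v).det)⁻¹) u := hd.inv hu.ne_zero
  intro i j
  have e : ∀ v, (F v)⁻¹ i j = ((F v).det)⁻¹ *
      (!![F v 1 1, -F v 0 1; -F v 1 0, F v 0 0] : Matrix (Fin 2) (Fin 2) ℂ) i j := fun v => by
    rw [Matrix.inv_def, Ring.inverse_eq_inv', Matrix.adjugate_fin_two, Matrix.smul_apply,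
      smul_eq_mul]
  simp only [e]
  refine hd'.mul ?_
  fin_cases i <;> fin_cases j
  · exact hF 1 1
  · exact (hF 0 1).neg
  · exact (hF 1 0).neg
  · exact hF 0 0

lemma MatContDiffAt.exists_hasDerivAt {F : ℝ → Matrix a b ℂ} (hF : MatContDiffAt 1 F t) :
    ∃ F', MatHasDerivAt F F' t :=
  ⟨fun i j => deriv (fun s => F s i j) t, fun i j =>
    ((hF i j).differentiableAt one_ne_zero).hasDerivAt⟩

lemma MatHasDerivAt.add {F G : ℝ → Matrix a b ℂ} {F' G' : Matrix a b ℂ}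
    (hF : MatHasDerivAt F F' t) (hG : MatHasDerivAt G G' t) :
    MatHasDerivAt (fun s => F s + G s) (F' + G') t :=
  fun i j => (hF i j).add (hG i j)

lemma MatHasDerivAt.sub {F G : ℝ → Matrix a b ℂ} {F' G' : Matrix a b ℂ}
    (hF : MatHasDerivAt F F' t) (hG : MatHasDerivAt G G' t) :
    MatHasDerivAt (fun s => F s - G s) (F' - G') t :=
  fun i j => (hF i j).sub (hG i j)

lemma MatHasDerivAt.const (C : Matrix a b ℂ) : MatHasDerivAt (fun _ => C) 0 t :=
  fun _ _ => hasDerivAt_const _ _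

lemma MatHasDerivAt.mul [Fintype b] {F : ℝ → Matrix a b ℂ} {F' : Matrix a b ℂ}
    {G : ℝ → Matrix b c ℂ} {G' : Matrix b c ℂ}
    (hF : MatHasDerivAt F F' t) (hG : MatHasDerivAt G G' t) :
    MatHasDerivAt (fun s => F s * G s) (F' * G t + F t * G') t := fun i j => by
  simp only [Matrix.mul_apply, Matrix.add_apply, ← Finset.sum_add_distrib]
  exact HasDerivAt.fun_sum fun k _ => (hF i k).mul (hG k j)

lemma MatHasDerivAt.conjTranspose {F : ℝ → Matrix a b ℂ} {F' : Matrix a b ℂ}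
    (hF : MatHasDerivAt F F' t) : MatHasDerivAt (fun s => (F s)ᴴ) F'ᴴ t :=
  fun i j => (hF j i).star

lemma MatHasDerivAt.trace [Fintype a] {F : ℝ → Matrix a a ℂ} {F' : Matrix a a ℂ}
    (hF : MatHasDerivAt F F' t) : HasDerivAt (fun s => (F s).trace) F'.trace t := by
  simp only [Matrix.trace, Matrix.diag_apply]
  exact HasDerivAt.fun_sum fun i _ => hF i i

lemma MatHasDerivAt.unique {F : ℝ → Matrix a b ℂ} {F' G' : Matrix a b ℂ}
    (h : MatHasDerivAt F F' t) (h' : MatHasDerivAt F G' t) : F' = G' := by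
  ext i j
  exact (h i j).unique (h' i j)

lemma MatHasDerivAt.congr_of_eventuallyEq {F G : ℝ → Matrix a b ℂ} {F' : Matrix a b ℂ}
    (h : MatHasDerivAt F F' t) (e : G =ᶠ[nhds t] F) : MatHasDerivAt G F' t := fun i j =>
  (h i j).congr_of_eventuallyEq (e.mono fun s hs => by simp [hs])

lemma matHasDerivAt_mat {m : ℕ} {X : ℝ → Coord m} {X' : Coord m} (h : HasDerivAt X X' t) :
    MatHasDerivAt (fun s => mat (X s)) (mat X') t :=
  fun i j => hasDerivAt_pi.1 (hasDerivAt_pi.1 h i) j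

lemma matContDiffAt_mat {m : ℕ} {X : E → Coord m} (h : ContDiffAt ℝ n X u) :
    MatContDiffAt n (fun v => mat (X v)) u :=
  fun i j => contDiffAt_pi.1 (contDiffAt_pi.1 h i) j

lemma MatHasDerivAt.hasDerivAt_vec {m : ℕ} {F : ℝ → Matrix (Fin 2) (Fin m) ℂ}
    {F' : Matrix (Fin 2) (Fin m) ℂ} (h : MatHasDerivAt F F' t) :
    HasDerivAt (fun s => vec (F s)) (vec F') t :=
  hasDerivAt_pi.2 fun i => hasDerivAt_pi.2 fun j => h i j

lemma MatContDiffAt.contDiffAt_vec {m : ℕ} {F : E → Matrix (Fin 2) (Fin m) ℂ}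
    (h : MatContDiffAt n F u) : ContDiffAt ℝ n (fun v => vec (F v)) u :=
  contDiffAt_pi.2 fun i => contDiffAt_pi.2 fun j => h i j

end MatrixCalculus

/-! ### The Hermitian form and the Levi-Civita connection in the chart -/

section Chart

variable {m : ℕ}

/-- `(1 - W Wᴴ)⁻¹`. -/
def leftWeight (W : Coord m) : Matrix (Fin 2) (Fin 2) ℂ := (1 - mat W * (mat W)ᴴ)⁻¹

/-- `(1 - Wᴴ W)⁻¹`. -/
def rightWeight (W : Coord m) : Matrix (Fin m) (Fin m) ℂ := (1 - (mat W)ᴴ * mat W)⁻¹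

/-- `Wᴴ (1 - W Wᴴ)⁻¹`. -/
def mixedWeight (W : Coord m) : Matrix (Fin m) (Fin 2) ℂ := (mat W)ᴴ * leftWeight W

/-- The Hermitian form whose real part is the metric. -/
def form (W X Y : Coord m) : ℂ :=
  (leftWeight W * mat X * rightWeight W * (mat Y)ᴴ).trace

lemma metric_eq_re_form (W X Y : Coord m) : metric W X Y = (form W X Y).re := rfl

/-- The closed formula for the Christoffel symbol. -/
def gam (W X Y : Coord m) : Coord m :=
  vec (mat X * mixedWeight W * mat Y + mat Y * mixedWeight W * mat X)

/-- The points at which the weights are nonsingular. -/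
def Regular (W : Coord m) : Prop := IsUnit (1 - mat W * (mat W)ᴴ).det

lemma regular_coord (p : Space m) : Regular (coord p) := by
  have h : coord p ∈ Set.range (coord (m := m)) := ⟨p, rfl⟩
  rw [range_coord] at h
  exact (Matrix.isUnit_iff_isUnit_det _).1 (Matrix.PosDef.isUnit h)

lemma Regular.right {W : Coord m} (h : Regular W) : IsUnit (1 - (mat W)ᴴ * mat W).det := by
  rw [Matrix.det_one_sub_mul_comm]; exact h

lemma Regular.leftWeight_mul {W : Coord m} (h : Regular W) :
    leftWeight W * (1 - mat W * (mat W)ᴴ) = 1 := Matrix.nonsing_inv_mul _ h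

lemma Regular.mul_leftWeight {W : Coord m} (h : Regular W) :
    (1 - mat W * (mat W)ᴴ) * leftWeight W = 1 := Matrix.mul_nonsing_inv _ h

lemma Regular.rightWeight_mul {W : Coord m} (h : Regular W) :
    rightWeight W * (1 - (mat W)ᴴ * mat W) = 1 := Matrix.nonsing_inv_mul _ h.right

lemma conjTranspose_leftWeight (W : Coord m) : (leftWeight W)ᴴ = leftWeight W := by
  simp [leftWeight, Matrix.conjTranspose_nonsing_inv]

lemma conjTranspose_rightWeight (W : Coord m) : (rightWeight W)ᴴ = rightWeight W := by
  simp [rightWeight, Matrix.conjTranspose_nonsing_inv]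

/-- The push-through identity: `Wᴴ` intertwines `1 - W Wᴴ` and `1 - Wᴴ W` (this is `e`), hence also
their inverses. -/
lemma Regular.mixedWeight_eq {W : Coord m} (h : Regular W) :
    mixedWeight W = rightWeight W * (mat W)ᴴ := by
  have e : (1 - (mat W)ᴴ * mat W) * (mat W)ᴴ = (mat W)ᴴ * (1 - mat W * (mat W)ᴴ) := by
    simp only [Matrix.mul_sub, Matrix.sub_mul, Matrix.mul_one, Matrix.one_mul, Matrix.mul_assoc]
  calc mixedWeight W
      = (rightWeight W * (1 - (mat W)ᴴ * mat W)) * ((mat W)ᴴ * leftWeight W) := by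
        rw [h.rightWeight_mul, Matrix.one_mul, mixedWeight]
    _ = rightWeight W * ((1 - (mat W)ᴴ * mat W) * (mat W)ᴴ) * leftWeight W := by
        simp only [Matrix.mul_assoc]
    _ = rightWeight W * (mat W)ᴴ * ((1 - mat W * (mat W)ᴴ) * leftWeight W) := by
        rw [e]; simp only [Matrix.mul_assoc]
    _ = rightWeight W * (mat W)ᴴ := by rw [h.mul_leftWeight, Matrix.mul_one]

/-- Eliminates the `m × m` inverse: smoothness and derivatives of `rightWeight` follow from those of
the `2 × 2` matrix `leftWeight`. -/
lemma Regular.rightWeight_eq {W : Coord m} (h : Regular W) :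
    rightWeight W = 1 + mixedWeight W * mat W := by
  have := h.rightWeight_mul
  rw [Matrix.mul_sub, Matrix.mul_one, sub_eq_iff_eq_add, ← Matrix.mul_assoc] at this
  rw [h.mixedWeight_eq]
  exact this

lemma conjTranspose_mixedWeight (W : Coord m) : (mixedWeight W)ᴴ = leftWeight W * mat W := by
  rw [mixedWeight, Matrix.conjTranspose_mul, conjTranspose_leftWeight,
    Matrix.conjTranspose_conjTranspose]

lemma eventually_regular {E : Type*} [TopologicalSpace E] {W : E → Coord m} {u : E}
    (hW : ContinuousAt W u) (h : Regular (W u)) : ∀ᶠ v in nhds u, Regular (W v) := by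
  have hc : Continuous fun V : Coord m => (1 - mat V * (mat V)ᴴ).det :=
    (continuous_const.sub ((continuous_id (X := Coord m)).matrix_mul
      (continuous_id (X := Coord m)).matrix_conjTranspose)).matrix_det
  have := (hc.continuousAt (x := W u)).comp hW
  filter_upwards [this.eventually_ne (IsUnit.ne_zero h)] with v hv
  exact isUnit_iff_ne_zero.2 hv

section Smooth

variable {E : Type*} [NormedAddCommGroup E] [NormedSpace ℝ E] {n : WithTop ℕ∞} {u : E}
  {W X Y : E → Coord m}

lemma matContDiffAt_gram (hW : ContDiffAt ℝ n W u) :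
    MatContDiffAt n (fun v => 1 - mat (W v) * (mat (W v))ᴴ) u :=
  (MatContDiffAt.const 1).sub ((matContDiffAt_mat hW).mul (matContDiffAt_mat hW).conjTranspose)

lemma matContDiffAt_leftWeight (hW : ContDiffAt ℝ n W u) (h : Regular (W u)) :
    MatContDiffAt n (fun v => leftWeight (W v)) u :=
  (matContDiffAt_gram hW).inv h

lemma matContDiffAt_mixedWeight (hW : ContDiffAt ℝ n W u) (h : Regular (W u)) :
    MatContDiffAt n (fun v => mixedWeight (W v)) u :=
  (matContDiffAt_mat hW).conjTranspose.mul (matContDiffAt_leftWeight hW h)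

lemma matContDiffAt_rightWeight (hW : ContDiffAt ℝ n W u) (h : Regular (W u)) :
    MatContDiffAt n (fun v => rightWeight (W v)) u := by
  have h1 : MatContDiffAt n (fun v => 1 + mixedWeight (W v) * mat (W v)) u :=
    (MatContDiffAt.const 1).add ((matContDiffAt_mixedWeight hW h).mul (matContDiffAt_mat hW))
  intro i j
  refine (h1 i j).congr_of_eventuallyEq ?_
  filter_upwards [eventually_regular hW.continuousAt h] with v hv
  rw [hv.rightWeight_eq]

lemma contDiffAt_form (hW : ContDiffAt ℝ n W u) (h : Regular (W u)) (hX : ContDiffAt ℝ n X u)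
    (hY : ContDiffAt ℝ n Y u) : ContDiffAt ℝ n (fun v => form (W v) (X v) (Y v)) u :=
  ((((matContDiffAt_leftWeight hW h).mul (matContDiffAt_mat hX)).mul
    (matContDiffAt_rightWeight hW h)).mul (matContDiffAt_mat hY).conjTranspose).trace

lemma contDiffAt_gam (hW : ContDiffAt ℝ n W u) (h : Regular (W u)) (hX : ContDiffAt ℝ n X u)
    (hY : ContDiffAt ℝ n Y u) : ContDiffAt ℝ n (fun v => gam (W v) (X v) (Y v)) u :=
  ((((matContDiffAt_mat hX).mul (matContDiffAt_mixedWeight hW h)).mul (matContDiffAt_mat hY)).add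
    (((matContDiffAt_mat hY).mul (matContDiffAt_mixedWeight hW h)).mul
      (matContDiffAt_mat hX))).contDiffAt_vec

end Smooth

/-! ### Derivatives of the weights, the Hermitian form and the Christoffel symbol along curves -/

section Derivative

variable {t : ℝ} {W X Y : ℝ → Coord m} {W' X' Y' : Coord m}

/-- The derivative of `(1 - W Wᴴ)⁻¹` along a curve. -/
lemma matHasDerivAt_leftWeight (hs : ContDiffAt ℝ 1 W t) (hW : HasDerivAt W W' t)
    (h : Regular (W t)) :
    MatHasDerivAt (fun s => leftWeight (W s))
      (leftWeight (W t) * mat W' * mixedWeight (W t)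
        + (mixedWeight (W t))ᴴ * (mat W')ᴴ * leftWeight (W t)) t := by
  obtain ⟨F', hF⟩ := (matContDiffAt_leftWeight hs h).exists_hasDerivAt
  have hM := matHasDerivAt_mat hW
  -- Differentiate `P (1 - W Wᴴ) = 1`, which holds near `t`, and multiply by `P` on the right to
  -- solve for `F'`.
  have h1 := hF.mul ((MatHasDerivAt.const 1).sub (hM.mul hM.conjTranspose))
  have h2 : MatHasDerivAt
      (fun s => leftWeight (W s) * (1 - mat (W s) * (mat (W s))ᴴ)) 0 t := by
    refine (MatHasDerivAt.const 1).congr_of_eventuallyEq ?_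
    filter_upwards [eventually_regular hs.continuousAt h] with s hs
    exact hs.leftWeight_mul
  have e := congrArg (fun Z => Z * leftWeight (W t)) (h1.unique h2)
  simp only [Matrix.add_mul, Matrix.mul_assoc, h.mul_leftWeight, Matrix.mul_one, zero_sub,
    Matrix.zero_mul, Matrix.neg_mul, Matrix.mul_neg, Matrix.mul_add] at e
  have e' : F' = leftWeight (W t) * mat W' * mixedWeight (W t)
        + (mixedWeight (W t))ᴴ * (mat W')ᴴ * leftWeight (W t) := by
    rw [conjTranspose_mixedWeight, mixedWeight]
    simp only [Matrix.mul_assoc]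
    exact add_neg_eq_zero.1 e
  rwa [← e']

lemma matHasDerivAt_mixedWeight (hs : ContDiffAt ℝ 1 W t) (hW : HasDerivAt W W' t)
    (h : Regular (W t)) :
    MatHasDerivAt (fun s => mixedWeight (W s))
      (rightWeight (W t) * (mat W')ᴴ * leftWeight (W t)
        + mixedWeight (W t) * mat W' * mixedWeight (W t)) t := by
  have h1 := (matHasDerivAt_mat hW).conjTranspose.mul (matHasDerivAt_leftWeight hs hW h)
  convert! h1 using 1
  rw [h.rightWeight_eq, conjTranspose_mixedWeight, mixedWeight]
  simp only [Matrix.mul_add, Matrix.add_mul, Matrix.one_mul, Matrix.mul_assoc]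
  abel

lemma matHasDerivAt_rightWeight (hs : ContDiffAt ℝ 1 W t) (hW : HasDerivAt W W' t)
    (h : Regular (W t)) :
    MatHasDerivAt (fun s => rightWeight (W s))
      (rightWeight (W t) * (mat W')ᴴ * (mixedWeight (W t))ᴴ
        + mixedWeight (W t) * mat W' * rightWeight (W t)) t := by
  have h1 := (MatHasDerivAt.const 1).add
    ((matHasDerivAt_mixedWeight hs hW h).mul (matHasDerivAt_mat hW))
  have h2 := h1.congr_of_eventuallyEq (G := fun s => rightWeight (W s)) (by
    filter_upwards [eventually_regular hs.continuousAt h] with s hs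
    exact hs.rightWeight_eq)
  convert! h2 using 1
  -- Only the `Q` in the summand `K W' Q` is expanded; the `Q` in `Q W'ᴴ Kᴴ` occurs on both sides.
  nth_rewrite 2 [h.rightWeight_eq]
  rw [conjTranspose_mixedWeight]
  simp only [Matrix.mul_add, Matrix.add_mul, Matrix.mul_one, Matrix.mul_assoc, zero_add]
  abel

lemma form_add_left (W X X' Y : Coord m) : form W (X + X') Y = form W X Y + form W X' Y := by
  simp only [form, mat, ← Matrix.of_add_of, Matrix.mul_add, Matrix.add_mul, Matrix.trace_add]

lemma form_add_right (W X Y Y' : Coord m) : form W X (Y + Y') = form W X Y + form W X Y' := by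
  simp only [form, mat, ← Matrix.of_add_of, Matrix.mul_add, Matrix.conjTranspose_add,
    Matrix.trace_add]

/-- The Hermitian form is parallel for the connection given by `gam`. -/
lemma hasDerivAt_form (hs : ContDiffAt ℝ 1 W t) (hW : HasDerivAt W W' t) (h : Regular (W t))
    (hX : HasDerivAt X X' t) (hY : HasDerivAt Y Y' t) :
    HasDerivAt (fun s => form (W s) (X s) (Y s))
      (form (W t) (X' + gam (W t) W' (X t)) (Y t)
        + form (W t) (X t) (Y' + gam (W t) W' (Y t))) t := by
  have h1 := ((((matHasDerivAt_leftWeight hs hW h).mul (matHasDerivAt_mat hX)).mul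
    (matHasDerivAt_rightWeight hs hW h)).mul (matHasDerivAt_mat hY).conjTranspose).trace
  convert! h1 using 1
  rw [form_add_left, form_add_right]
  simp only [form, gam, mat, vec, Equiv.apply_symm_apply, Matrix.mul_add, Matrix.add_mul,
    Matrix.trace_add, Matrix.conjTranspose_add, Matrix.conjTranspose_mul]
  set P := leftWeight (W t)
  set Q := rightWeight (W t)
  set K := mixedWeight (W t)
  -- Three of the four connection terms match the derivatives of `P` and `Q` as they stand. The term
  -- `W' K Y` in the second argument has to be rotated cyclically to give the part `Kᴴ W'ᴴ P` of the
  -- derivative of `P`.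
  have e : (P * Matrix.of (X t) * Q * ((Matrix.of (Y t))ᴴ * (Kᴴ * (Matrix.of W')ᴴ))).trace =
      (Kᴴ * (Matrix.of W')ᴴ * P * Matrix.of (X t) * Q * (Matrix.of (Y t))ᴴ).trace := by
    rw [← Matrix.mul_assoc _ _ (Kᴴ * (Matrix.of W')ᴴ), Matrix.trace_mul_comm]
    simp only [Matrix.mul_assoc]
  rw [e]
  simp only [Matrix.mul_assoc]
  ring

lemma hasDerivAt_gam (hs : ContDiffAt ℝ 1 W t) (hW : HasDerivAt W W' t) (h : Regular (W t))
    (hX : HasDerivAt X X' t) (hY : HasDerivAt Y Y' t) :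
    HasDerivAt (fun s => gam (W s) (X s) (Y s))
      (gam (W t) X' (Y t) + gam (W t) (X t) Y'
        + vec (mat (X t) * (rightWeight (W t) * (mat W')ᴴ * leftWeight (W t)
            + mixedWeight (W t) * mat W' * mixedWeight (W t)) * mat (Y t)
          + mat (Y t) * (rightWeight (W t) * (mat W')ᴴ * leftWeight (W t)
            + mixedWeight (W t) * mat W' * mixedWeight (W t)) * mat (X t))) t := by
  have hK := matHasDerivAt_mixedWeight hs hW h
  have hX' := matHasDerivAt_mat hX
  have hY' := matHasDerivAt_mat hY
  have h1 := (((hX'.mul hK).mul hY').add ((hY'.mul hK).mul hX')).hasDerivAt_vec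
  convert! h1 using 1
  apply Matrix.of.injective
  simp only [gam, mat, vec, ← Matrix.of_add_of, Equiv.apply_symm_apply, Matrix.mul_add,
    Matrix.add_mul]
  abel

end Derivative

end Chart

/-! ### Sesquilinearity, positivity and compatibility with the complex structure -/

section HermitianForm

variable {m : ℕ}

lemma form_smul_left (W : Coord m) (c : ℂ) (X Y : Coord m) :
    form W (c • X) Y = c * form W X Y := by
  have h : mat (c • X) = c • mat X := rfl
  simp only [form, h, Matrix.mul_smul, Matrix.smul_mul, Matrix.trace_smul, smul_eq_mul]

lemma star_form (W X Y : Coord m) : star (form W X Y) = form W Y X := by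
  rw [form, ← Matrix.trace_conjTranspose, form]
  simp only [Matrix.conjTranspose_mul, Matrix.conjTranspose_conjTranspose,
    conjTranspose_leftWeight, conjTranspose_rightWeight]
  rw [← Matrix.mul_assoc, ← Matrix.mul_assoc, Matrix.trace_mul_comm]
  simp only [Matrix.mul_assoc]

lemma form_smul_right (W : Coord m) (c : ℂ) (X Y : Coord m) :
    form W X (c • Y) = star c * form W X Y := by
  rw [← star_form, form_smul_left, star_mul', star_form]

lemma metric_comm (W X Y : Coord m) : metric W X Y = metric W Y X := by
  rw [metric_eq_re_form, metric_eq_re_form, ← star_form W Y X]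
  rfl

lemma metric_add_left (W X X' Y : Coord m) :
    metric W (X + X') Y = metric W X Y + metric W X' Y := by
  simp only [metric_eq_re_form, form_add_left, Complex.add_re]

lemma metric_add_right (W X Y Y' : Coord m) :
    metric W X (Y + Y') = metric W X Y + metric W X Y' := by
  simp only [metric_eq_re_form, form_add_right, Complex.add_re]

lemma metric_smul_left (W : Coord m) (r : ℝ) (X Y : Coord m) :
    metric W (r • X) Y = r * metric W X Y := by
  have h : r • X = (r : ℂ) • X := by ext i j; simp
  rw [metric_eq_re_form, h, form_smul_left, Complex.re_ofReal_mul, metric_eq_re_form]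

lemma metric_smul_right (W : Coord m) (r : ℝ) (X Y : Coord m) :
    metric W X (r • Y) = r * metric W X Y := by
  rw [metric_comm, metric_smul_left, metric_comm]

lemma metric_neg_left (W X Y : Coord m) : metric W (-X) Y = -metric W X Y := by
  rw [← neg_one_smul ℝ X, metric_smul_left]; ring

lemma metric_neg_right (W X Y : Coord m) : metric W X (-Y) = -metric W X Y := by
  rw [metric_comm, metric_neg_left, metric_comm]

lemma metric_sub_left (W X X' Y : Coord m) :
    metric W (X - X') Y = metric W X Y - metric W X' Y := by
  rw [sub_eq_add_neg, metric_add_left, metric_neg_left]; ring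

lemma metric_zero_left (W Y : Coord m) : metric W 0 Y = 0 := by
  simpa using metric_smul_left W 0 0 Y

lemma kaehler_apply (X : Coord m) : kaehler X = Complex.I • X := rfl

lemma kaehler_kaehler (X : Coord m) : kaehler (kaehler X) = -X := by
  rw [kaehler_apply, kaehler_apply, smul_smul, Complex.I_mul_I, neg_one_smul]

lemma metric_kaehler (W X Y : Coord m) :
    metric W (kaehler X) (kaehler Y) = metric W X Y := by
  rw [metric_eq_re_form, kaehler_apply, kaehler_apply, form_smul_left, form_smul_right,
    ← mul_assoc]
  simp [metric_eq_re_form]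

lemma metric_kaehler_left (W X Y : Coord m) :
    metric W (kaehler X) Y = -metric W X (kaehler Y) := by
  rw [← metric_kaehler W X, kaehler_kaehler, metric_neg_right, neg_neg]

/-- At `p = g o` the weights are `A Aᴴ` and `D Dᴴ`, with `A` and `D` the diagonal blocks of `g`, so
the squared length of `X` is the squared Frobenius norm of `Aᴴ X D`, and `A` and `D` are invertible.
-/
lemma metric_self_pos (p : Space m) {X : Coord m} (hX : X ≠ 0) : 0 < metric (coord p) X X := by
  induction p using QuotientGroup.induction_on with
  | H g =>
  obtain ⟨p1, p2⟩ := one_sub_coord_mul g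
  have hu := (Matrix.isUnit_iff_isUnit_det _).1 (isUnit_blockD g)
  have haH : IsUnit ((blockA g)ᴴ).det := by
    rw [Matrix.det_conjTranspose]
    exact ((Matrix.isUnit_iff_isUnit_det _).1 (isUnit_blockA g)).star
  set Z := (blockA g)ᴴ * mat X * blockD g with hZ
  have e : metric (coord (g : Space m)) X X = ((Z * Zᴴ).trace).re := by
    rw [metric, p1, p2, hZ]
    simp only [Matrix.conjTranspose_mul, Matrix.conjTranspose_conjTranspose]
    rw [Matrix.mul_assoc (blockA g), Matrix.mul_assoc (blockA g), Matrix.mul_assoc (blockA g),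
      Matrix.trace_mul_comm]
    simp only [Matrix.mul_assoc]
  have hne : Z ≠ 0 := by
    intro h0
    apply hX
    have h1 : mat X = ((blockA g)ᴴ)⁻¹ * Z * (blockD g)⁻¹ := by
      rw [hZ, Matrix.mul_assoc (blockA g)ᴴ, Matrix.nonsing_inv_mul_cancel_left _ _ haH,
        Matrix.mul_assoc, Matrix.mul_nonsing_inv _ hu, Matrix.mul_one]
    rw [h0, Matrix.mul_zero, Matrix.zero_mul] at h1
    exact h1
  rw [e]
  have h2 : 0 ≤ (Z * Zᴴ).trace := (Matrix.posSemidef_self_mul_conjTranspose Z).trace_nonneg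
  have h3 : (Z * Zᴴ).trace ≠ 0 := by
    rwa [Ne, Matrix.trace_mul_conjTranspose_self_eq_zero_iff]
  exact (Complex.lt_def.1 (lt_of_le_of_ne h2 h3.symm)).1

lemma eq_of_metric_eq (p : Space m) {X Y : Coord m}
    (h : ∀ U, metric (coord p) X U = metric (coord p) Y U) : X = Y := by
  by_contra hne
  have := metric_self_pos p (sub_ne_zero.2 hne)
  rw [metric_sub_left, h, sub_self] at this
  exact lt_irrefl _ this

lemma gam_comm (W X Y : Coord m) : gam W X Y = gam W Y X := by
  rw [gam, gam, add_comm]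

/-- The Kähler condition: complex linearity of the Christoffel symbol says that `J` is parallel. -/
lemma gam_smul_right (W : Coord m) (c : ℂ) (X Y : Coord m) :
    gam W X (c • Y) = c • gam W X Y := by
  have h : mat (c • Y) = c • mat Y := rfl
  simp only [gam, h, Matrix.mul_smul, Matrix.smul_mul, ← smul_add]
  rfl

end HermitianForm

/-! ### Covariant derivatives along a map -/

section Covariant

variable {m : ℕ} {E : Type*} [NormedAddCommGroup E] [NormedSpace ℝ E]
  {f N V V₁ V₂ : E → Coord m} {u : E}

/-- The covariant derivative along `f` of the vector field `V` in the direction `v`. -/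
def cov (f V : E → Coord m) (u v : E) : Coord m :=
  fderiv ℝ V u v + gam (f u) (fderiv ℝ f u v) (V u)

lemma hasDerivAt_line (u v : E) (t : ℝ) : HasDerivAt (fun s : ℝ => u + s • v) v t := by
  simpa using ((hasDerivAt_id t).smul_const v).const_add u

lemma contDiffAt_comp_line {F : Type*} [NormedAddCommGroup F] [NormedSpace ℝ F] {h : E → F}
    {n : WithTop ℕ∞} (hh : ContDiffAt ℝ n h u) (v : E) :
    ContDiffAt ℝ n (fun s : ℝ => h (u + s • v)) 0 := by
  have h1 : ContDiffAt ℝ n (fun s : ℝ => u + s • v) 0 := by fun_prop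
  have h2 : ContDiffAt ℝ n h ((fun s : ℝ => u + s • v) 0) := by simpa using hh
  exact h2.comp (0 : ℝ) h1

/-- Restriction to lines transfers the derivative formulas along curves to Fréchet derivatives. -/
lemma hasDerivAt_comp_line {F : Type*} [NormedAddCommGroup F] [NormedSpace ℝ F] {h : E → F}
    (hh : DifferentiableAt ℝ h u) (v : E) :
    HasDerivAt (fun s : ℝ => h (u + s • v)) (fderiv ℝ h u v) 0 := by
  have h2 : HasFDerivAt h (fderiv ℝ h u) (u + (0 : ℝ) • v) := by simpa using hh.hasFDerivAt
  exact h2.comp_hasDerivAt (0 : ℝ) (hasDerivAt_line u v 0)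

lemma fderiv_form (hf : ContDiffAt ℝ 1 f u) (h : Regular (f u)) (h₁ : ContDiffAt ℝ 1 V₁ u)
    (h₂ : ContDiffAt ℝ 1 V₂ u) (v : E) :
    fderiv ℝ (fun w => form (f w) (V₁ w) (V₂ w)) u v =
      form (f u) (cov f V₁ u v) (V₂ u) + form (f u) (V₁ u) (cov f V₂ u v) := by
  have d := hasDerivAt_comp_line
    ((contDiffAt_form hf h h₁ h₂).differentiableAt one_ne_zero) v
  have d' := hasDerivAt_form (contDiffAt_comp_line hf v)
    (hasDerivAt_comp_line (hf.differentiableAt one_ne_zero) v) (by simpa using h)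
    (hasDerivAt_comp_line (h₁.differentiableAt one_ne_zero) v)
    (hasDerivAt_comp_line (h₂.differentiableAt one_ne_zero) v)
  have := d.unique d'
  simpa [cov] using this

lemma contDiffAt_metric {n : WithTop ℕ∞} (hf : ContDiffAt ℝ n f u) (h : Regular (f u))
    (h₁ : ContDiffAt ℝ n V₁ u) (h₂ : ContDiffAt ℝ n V₂ u) :
    ContDiffAt ℝ n (fun w => metric (f w) (V₁ w) (V₂ w)) u :=
  Complex.reCLM.contDiff.contDiffAt.comp u (contDiffAt_form hf h h₁ h₂)

/-- The connection is compatible with the metric. -/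
lemma fderiv_metric (hf : ContDiffAt ℝ 1 f u) (h : Regular (f u)) (h₁ : ContDiffAt ℝ 1 V₁ u)
    (h₂ : ContDiffAt ℝ 1 V₂ u) (v : E) :
    fderiv ℝ (fun w => metric (f w) (V₁ w) (V₂ w)) u v =
      metric (f u) (cov f V₁ u v) (V₂ u) + metric (f u) (V₁ u) (cov f V₂ u v) := by
  have e := (Complex.reCLM.hasFDerivAt.comp u
    ((contDiffAt_form hf h h₁ h₂).differentiableAt one_ne_zero).hasFDerivAt).fderiv
  have e' := congrArg (fun T => T v) e
  simp only [ContinuousLinearMap.comp_apply, fderiv_form hf h h₁ h₂ v] at e'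
  exact e'.trans (by simp [metric_eq_re_form])

lemma isChristoffel_gam {W : Coord m} (h : Regular W) (X Y : Coord m) :
    IsChristoffel W X Y (gam W X Y) := by
  intro U
  -- Metric compatibility applied to constant fields along the identity map. Three instances,
  -- together with the symmetry of `gam`, give the Koszul combination.
  have key : ∀ X Y U : Coord m, fderiv ℝ (fun W' => metric W' Y U) W X =
      metric W (gam W X Y) U + metric W Y (gam W X U) := by
    intro X Y U
    have := fderiv_metric (f := fun w : Coord m => w) (V₁ := fun _ => Y) (V₂ := fun _ => U)
      contDiffAt_id h contDiffAt_const contDiffAt_const X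
    simpa [cov] using this
  rw [key, key, key, gam_comm W Y X, gam_comm W U X, gam_comm W U Y, metric_comm W Y,
    metric_comm W X (gam W Y U), metric_comm W (gam W X U)]
  ring

/-- The Christoffel symbol is given by the closed formula. -/
lemma christoffel_eq_gam (p : Space m) (X Y : Coord m) :
    christoffel (coord p) X Y = gam (coord p) X Y := by
  have h := isChristoffel_gam (regular_coord p) X Y
  -- The closed formula witnesses existence, so the chosen value satisfies the defining property;
  -- nondegeneracy then forces equality.
  have h' : IsChristoffel (coord p) X Y (christoffel (coord p) X Y) :=
    Classical.epsilon_spec ⟨_, h⟩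
  apply eq_of_metric_eq p
  intro U
  linarith [h U, h' U]

lemma cov_smul (c : ℂ) (hV : DifferentiableAt ℝ V u) (v : E) :
    cov f (fun w => c • V w) u v = c • cov f V u v := by
  have : fderiv ℝ (fun w => c • V w) u = c • fderiv ℝ V u := fderiv_fun_const_smul hV c
  rw [cov, cov, this, gam_smul_right, smul_add]
  rfl

/-- The connection is torsion free. -/
lemma cov_fderiv_comm (hf : ContDiffAt ℝ 2 f u) (v w : E) :
    cov f (fun z => fderiv ℝ f z w) u v = cov f (fun z => fderiv ℝ f z v) u w := by
  have hd : DifferentiableAt ℝ (fderiv ℝ f) u :=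
    (hf.fderiv_right (m := 1) (by norm_num)).differentiableAt one_ne_zero
  have e : ∀ v w, fderiv ℝ (fun z => fderiv ℝ f z w) u v = fderiv ℝ (fderiv ℝ f) u v w := by
    intro v w
    rw [fderiv_clm_apply hd (differentiableAt_const w)]
    simp
  rw [cov, cov, e, e, gam_comm]
  congr 1
  exact (hf.isSymmSndFDerivAt (by simp)).eq v w

/-- The curvature tensor of the connection. -/
def curv (W X Y Z : Coord m) : Coord m :=
  vec ((mat Y * rightWeight W * (mat X)ᴴ - mat X * rightWeight W * (mat Y)ᴴ)
      * leftWeight W * mat Z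
    + mat Z * rightWeight W
      * ((mat X)ᴴ * leftWeight W * mat Y - (mat Y)ᴴ * leftWeight W * mat X))

lemma contDiffAt_cov {n n' : WithTop ℕ∞} (hn : n + 1 ≤ n') (hf : ContDiffAt ℝ n' f u)
    (h : Regular (f u)) (hV : ContDiffAt ℝ n' V u) (w : E) :
    ContDiffAt ℝ n (fun z => cov f V z w) u := by
  have hn' : n ≤ n' := le_trans le_self_add hn
  have h1 : ContDiffAt ℝ n (fun z => fderiv ℝ V z w) u :=
    (hV.fderiv_right hn).clm_apply contDiffAt_const
  have h2 : ContDiffAt ℝ n (fun z => fderiv ℝ f z w) u :=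
    (hf.fderiv_right hn).clm_apply contDiffAt_const
  exact h1.add (contDiffAt_gam (hf.of_le hn') h h2 (hV.of_le hn'))

/-- The commutator of second covariant derivatives. -/
lemma cov_cov_sub (hf : ContDiffAt ℝ 2 f u) (h : Regular (f u)) (hV : ContDiffAt ℝ 2 V u)
    (v w : E) :
    cov f (fun z => cov f V z w) u v - cov f (fun z => cov f V z v) u w =
      curv (f u) (fderiv ℝ f u v) (fderiv ℝ f u w) (V u) := by
  have h12 : (1 : WithTop ℕ∞) + 1 ≤ 2 := by norm_num
  have hf1 : ContDiffAt ℝ 1 f u := hf.of_le (by norm_num)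
  have hV1 : ContDiffAt ℝ 1 V u := hV.of_le (by norm_num)
  have hdf : DifferentiableAt ℝ (fderiv ℝ f) u :=
    (hf.fderiv_right h12).differentiableAt one_ne_zero
  have hdV : DifferentiableAt ℝ (fderiv ℝ V) u :=
    (hV.fderiv_right h12).differentiableAt one_ne_zero
  have key : ∀ v w, fderiv ℝ (fun z => cov f V z w) u v =
      fderiv ℝ (fderiv ℝ V) u v w + (gam (f u) (fderiv ℝ (fderiv ℝ f) u v w) (V u)
        + gam (f u) (fderiv ℝ f u w) (fderiv ℝ V u v)
        + vec (mat (fderiv ℝ f u w) * (rightWeight (f u) * (mat (fderiv ℝ f u v))ᴴ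
            * leftWeight (f u)
            + mixedWeight (f u) * mat (fderiv ℝ f u v) * mixedWeight (f u)) * mat (V u)
          + mat (V u) * (rightWeight (f u) * (mat (fderiv ℝ f u v))ᴴ * leftWeight (f u)
            + mixedWeight (f u) * mat (fderiv ℝ f u v) * mixedWeight (f u))
              * mat (fderiv ℝ f u w))) := by
    intro v w
    have d := hasDerivAt_comp_line
      ((contDiffAt_cov h12 hf h hV w).differentiableAt one_ne_zero) v
    have dapp : ∀ {g : E → Coord m}, DifferentiableAt ℝ (fderiv ℝ g) u →
        HasDerivAt (fun s : ℝ => fderiv ℝ g (u + s • v) w) (fderiv ℝ (fderiv ℝ g) u v w) 0 := by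
      intro g hg
      have := hasDerivAt_comp_line (h := fun z => fderiv ℝ g z w)
        (hg.clm_apply (differentiableAt_const w)) v
      rw [fderiv_clm_apply hg (differentiableAt_const w)] at this
      simpa using this
    have d' := (dapp hdV).add (hasDerivAt_gam (contDiffAt_comp_line hf1 v)
      (hasDerivAt_comp_line (hf1.differentiableAt one_ne_zero) v) (by simpa using h)
      (dapp hdf) (hasDerivAt_comp_line (hV1.differentiableAt one_ne_zero) v))
    have := d.unique d'
    simpa using this
  -- The second derivatives of `V` and `f` cancel by symmetry, and the terms containing `K` twice
  -- cancel against those of the iterated symbol `gam`. What survives comes from the part `Q W'ᴴ P`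
  -- of the derivative of `K`.
  have sV := (hV.isSymmSndFDerivAt (by simp)).eq v w
  have sf := (hf.isSymmSndFDerivAt (by simp)).eq v w
  simp only [cov] at key ⊢
  rw [key v w, key w v, sV, sf]
  apply Matrix.of.injective
  simp only [gam, curv, mat, vec, ← Matrix.of_add_of, ← Matrix.of_sub_of, Equiv.apply_symm_apply,
    Matrix.mul_add, Matrix.add_mul, Matrix.mul_sub, Matrix.sub_mul, Matrix.mul_assoc]
  abel

/-- The exterior derivative of the identity `g(∇N, JN) = α g(df, -JN)` of one-forms. -/
lemma exterior_derivative {α : E → ℝ} (hf : ContDiffAt ℝ 2 f u) (h : Regular (f u))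
    (hN : ContDiffAt ℝ 2 N u) (hα : DifferentiableAt ℝ α u)
    (hω : ∀ᶠ z in nhds u, ∀ w, metric (f z) (cov f N z w) (kaehler (N z)) =
      α z * -metric (f z) (fderiv ℝ f z w) (kaehler (N z))) (v w : E) :
    metric (f u) (curv (f u) (fderiv ℝ f u v) (fderiv ℝ f u w) (N u)) (kaehler (N u))
        + 2 * metric (f u) (cov f N u w) (kaehler (cov f N u v)) =
      fderiv ℝ α u v * -metric (f u) (fderiv ℝ f u w) (kaehler (N u))
        - fderiv ℝ α u w * -metric (f u) (fderiv ℝ f u v) (kaehler (N u))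
        + α u * (metric (f u) (fderiv ℝ f u v) (kaehler (cov f N u w))
          - metric (f u) (fderiv ℝ f u w) (kaehler (cov f N u v))) := by
  have h12 : (1 : WithTop ℕ∞) + 1 ≤ 2 := by norm_num
  have hf1 : ContDiffAt ℝ 1 f u := hf.of_le (by norm_num)
  have hN1 : ContDiffAt ℝ 1 N u := hN.of_le (by norm_num)
  have hJ : ContDiffAt ℝ 1 (fun z => kaehler (N z)) u := hN1.const_smul Complex.I
  have hJc : ∀ v, cov f (fun z => kaehler (N z)) u v = kaehler (cov f N u v) := fun v =>
    cov_smul Complex.I (hN1.differentiableAt one_ne_zero) v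
  -- The hypothesis `hω`, for a fixed direction `w`, differentiated in the direction `v`. In the
  -- difference of the two orders, `cov_cov_sub` produces the curvature and `cov_fderiv_comm`
  -- removes the second derivative of `f`.
  have key : ∀ v w, metric (f u) (cov f (fun z => cov f N z w) u v) (kaehler (N u))
        + metric (f u) (cov f N u w) (kaehler (cov f N u v)) =
      fderiv ℝ α u v * -metric (f u) (fderiv ℝ f u w) (kaehler (N u))
        - α u * (metric (f u) (cov f (fun z => fderiv ℝ f z w) u v) (kaehler (N u))
          + metric (f u) (fderiv ℝ f u w) (kaehler (cov f N u v))) := by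
    intro v w
    have hfw : ContDiffAt ℝ 1 (fun z => fderiv ℝ f z w) u :=
      (hf.fderiv_right h12).clm_apply contDiffAt_const
    have e : (fun z => metric (f z) (cov f N z w) (kaehler (N z))) =ᶠ[nhds u]
        fun z => α z * -metric (f z) (fderiv ℝ f z w) (kaehler (N z)) := by
      filter_upwards [hω] with z hz using hz w
    have e1 := DFunLike.congr_fun (e.fderiv_eq (𝕜 := ℝ)) v
    rw [fderiv_metric hf1 h (contDiffAt_cov h12 hf h hN w) hJ, hJc, fderiv_fun_mul hα
      ((contDiffAt_metric hf1 h hfw hJ).differentiableAt one_ne_zero).fun_neg, fderiv_fun_neg] at e1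
    simp only [add_apply, smul_apply,
      neg_apply, smul_eq_mul] at e1
    rw [fderiv_metric hf1 h hfw hJ, hJc] at e1
    rw [e1]
    ring
  have c := cov_cov_sub hf h hN v w
  have t := cov_fderiv_comm hf v w
  have k1 := key v w
  have k2 := key w v
  rw [← c, metric_sub_left]
  rw [t] at k1
  -- `J` is skew, so the two terms quadratic in `∇N` add up instead of cancelling; this is the
  -- factor `2`.
  have s : metric (f u) (cov f N u v) (kaehler (cov f N u w)) =
      -metric (f u) (cov f N u w) (kaehler (cov f N u v)) := by
    rw [metric_comm, metric_kaehler_left]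
  rw [s] at k2
  linarith

end Covariant

/-! ### The quaternionic structure -/

section Quaternionic

/-- A matrix that commutes with two anticommuting `2 × 2` matrices of square `-1` is scalar. -/
lemma exists_scalar_of_commute {a b T : Matrix (Fin 2) (Fin 2) ℂ} (hta : a.trace = 0)
    (htb : b.trace = 0) (ha : a * a = -1) (hb : b * b = -1) (hab : a * b = -(b * a))
    (hTa : T * a = a * T) (hTb : T * b = b * T) : ∃ c : ℂ, T = c • 1 := by
  have ea : a 1 1 = -a 0 0 := by
    rw [Matrix.trace_fin_two] at hta; linear_combination hta
  have eb : b 1 1 = -b 0 0 := by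
    rw [Matrix.trace_fin_two] at htb; linear_combination htb
  -- The traceless part `T₀` of a matrix commuting with `c` is a multiple `s c`. Since `c² = -1`,
  -- the coefficient `s` is minus the `(0,0)` entry of `T₀ c`.
  have key : ∀ c : Matrix (Fin 2) (Fin 2) ℂ, c 1 1 = -c 0 0 → c * c = -1 → T * c = c * T →
      ∃ s : ℂ, T 0 0 - T 1 1 = 2 * s * c 0 0 ∧ T 0 1 = s * c 0 1 ∧ T 1 0 = s * c 1 0 := by
    intro c hc hcc hT
    have h0 := congrFun (congrFun hcc 0) 0
    have h1 := congrFun (congrFun hT 0) 0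
    have h2 := congrFun (congrFun hT 0) 1
    have h3 := congrFun (congrFun hT 1) 0
    simp only [Matrix.mul_apply, Fin.sum_univ_two, Matrix.neg_apply, Matrix.one_apply_eq, hc]
      at h0 h1 h2 h3
    refine ⟨-((T 0 0 - T 1 1) / 2 * c 0 0 + T 0 1 * c 1 0), ?_, ?_, ?_⟩
    · linear_combination (T 0 0 - T 1 1) * h0 - c 1 0 * h2
    · linear_combination T 0 1 * h0 + c 0 0 / 2 * h2
    · linear_combination T 1 0 * h0 - c 0 0 / 2 * h3 + c 1 0 * h1
  obtain ⟨s, s1, s2, s3⟩ := key a ea ha hTa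
  obtain ⟨r, r1, r2, r3⟩ := key b eb hb hTb
  have h0 := congrFun (congrFun ha 0) 0
  have h1 := congrFun (congrFun hab 0) 0
  simp only [Matrix.mul_apply, Fin.sum_univ_two, Matrix.neg_apply, Matrix.one_apply_eq] at h0 h1
  -- The traceless part of `T` equals both `s a` and `r b`. Take the trace against `a`: `tr(a a) =
  -- -2`, while `tr(a b) = 0` by anticommutation.
  have hs : s = 0 := by
    linear_combination s * h0 - r / 2 * h1 - a 0 0 / 2 * (r1 - s1)
      - a 1 0 / 2 * (r2 - s2) - a 0 1 / 2 * (r3 - s3)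
  refine ⟨T 0 0, ?_⟩
  ext i j
  fin_cases i <;> fin_cases j
  · simp
  · simp [s2, hs]
  · simp [s3, hs]
  · simp only [hs, mul_zero, zero_mul] at s1
    simp [sub_eq_zero.1 s1]

/-- The completeness relation for a quaternionic basis of the traceless `2 × 2` matrices. -/
lemma sum_mul_mul {q : Fin 3 → Matrix (Fin 2) (Fin 2) ℂ} (htr : ∀ ν, (q ν).trace = 0)
    (hsq : ∀ ν, q ν * q ν = -1) (hmul : ∀ ν, q ν * q (ν + 1) = q (ν + 2))
    (hrev : ∀ ν, q (ν + 1) * q ν = -q (ν + 2)) (M : Matrix (Fin 2) (Fin 2) ℂ) :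
    ∑ ν, q ν * M * q ν = M - (2 * M.trace) • 1 := by
  have m0 : q 0 * q 1 = q 2 := hmul 0
  have m1 : q 1 * q 2 = q 0 := hmul 1
  have m2 : q 2 * q 0 = q 1 := hmul 2
  have n0 : q 1 * q 0 = -q 2 := hrev 0
  have n1 : q 2 * q 1 = -q 0 := hrev 1
  have n2 : q 0 * q 2 = -q 1 := hrev 2
  have s0 := hsq 0
  have s1 := hsq 1
  have s2 := hsq 2
  rw [Fin.sum_univ_three]
  -- As `q_ν⁻¹ = -q_ν`, this matrix is the sum of the conjugates of `M` by `1, q₀, q₁, q₂`, a sum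
  -- over the quaternion group modulo its centre. It therefore commutes with every `q_ν`, is scalar,
  -- and has trace `4 tr M`.
  have c0 : (M - (q 0 * M * q 0 + q 1 * M * q 1 + q 2 * M * q 2)) * q 0 =
      q 0 * (M - (q 0 * M * q 0 + q 1 * M * q 1 + q 2 * M * q 2)) := by
    simp only [mul_sub, sub_mul, mul_add, add_mul, mul_assoc, s0, n0, m2]
    simp only [← mul_assoc, s0, m0, n2]
    noncomm_ring
  have c1 : (M - (q 0 * M * q 0 + q 1 * M * q 1 + q 2 * M * q 2)) * q 1 =
      q 1 * (M - (q 0 * M * q 0 + q 1 * M * q 1 + q 2 * M * q 2)) := by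
    simp only [mul_sub, sub_mul, mul_add, add_mul, mul_assoc, s1, m0, n1]
    simp only [← mul_assoc, s1, n0, m1]
    noncomm_ring
  obtain ⟨c, hc⟩ := exists_scalar_of_commute (htr 0) (htr 1) s0 s1
    (by rw [m0, n0, neg_neg]) c0 c1
  have ht := congrArg Matrix.trace hc
  have e : ∀ ν, (q ν * M * q ν).trace = -M.trace := fun ν => by
    rw [Matrix.trace_mul_comm, ← mul_assoc, hsq, neg_one_mul, Matrix.trace_neg]
  simp only [Matrix.trace_sub, Matrix.trace_add, e, Matrix.trace_smul, Matrix.trace_one,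
    Fintype.card_fin, smul_eq_mul] at ht
  have hc' : c = 2 * M.trace := by push_cast at ht; linear_combination -ht / 2
  rw [← hc', ← hc]
  abel

/-- The Fierz identity. -/
lemma sum_trace_mul_trace {q : Fin 3 → Matrix (Fin 2) (Fin 2) ℂ}
    (hq : ∀ M, ∑ ν, q ν * M * q ν = M - (2 * M.trace) • 1) (M M' : Matrix (Fin 2) (Fin 2) ℂ) :
    ∑ ν, (q ν * M).trace * (q ν * M').trace = M.trace * M'.trace - 2 * (M * M').trace := by
  -- Evaluating the completeness relation on matrix units gives all entries of the tensor `∑ q_ν ⊗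
  -- q_ν`; the claim is its contraction with `M` and `M'`.
  have e : ∀ i j k l, ∑ ν, q ν i j * q ν k l =
      (if i = j ∧ k = l then 1 else 0) - (if i = l ∧ j = k then 2 else 0) := by
    intro i j k l
    have := congrFun (congrFun (hq (Matrix.single j k 1)) i) l
    rw [Matrix.sum_apply] at this
    fin_cases i <;> fin_cases j <;> fin_cases k <;> fin_cases l <;>
      simpa [Matrix.mul_apply, Fin.sum_univ_two, Matrix.single, Matrix.trace_fin_two] using this
  simp only [Fin.sum_univ_three] at e
  simp only [Matrix.trace_fin_two, Matrix.mul_apply, Fin.sum_univ_two, Fin.sum_univ_three]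
  have e00 := e 0 0
  have e01 := e 0 1
  have e10 := e 1 0
  have e11 := e 1 1
  simp only [Fin.forall_fin_two, Fin.isValue, ite_true, zero_ne_one, one_ne_zero,
    false_and, ite_false, sub_zero, zero_sub, true_and] at e00 e01 e10 e11
  linear_combination M 0 0 * M' 0 0 * e00.1.1 + M 0 0 * M' 1 0 * e00.1.2
    + M 0 0 * M' 0 1 * e00.2.1 + M 0 0 * M' 1 1 * e00.2.2
    + M 1 0 * M' 0 0 * e01.1.1 + M 1 0 * M' 1 0 * e01.1.2
    + M 1 0 * M' 0 1 * e01.2.1 + M 1 0 * M' 1 1 * e01.2.2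
    + M 0 1 * M' 0 0 * e10.1.1 + M 0 1 * M' 1 0 * e10.1.2
    + M 0 1 * M' 0 1 * e10.2.1 + M 0 1 * M' 1 1 * e10.2.2
    + M 1 1 * M' 0 0 * e11.1.1 + M 1 1 * M' 1 0 * e11.1.2
    + M 1 1 * M' 0 1 * e11.2.1 + M 1 1 * M' 1 1 * e11.2.2

variable {m : ℕ}

lemma mat_vec (X : Matrix (Fin 2) (Fin m) ℂ) : mat (vec X) = X := rfl

/-- The elements of the quaternionic structure are the left multiplications by the traceless
matrices that are skew for `(1 - W Wᴴ)⁻¹`. -/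
lemma exists_matrix_of_mem_quaternionic {p : Space m} {T : Coord m →ₗ[ℝ] Coord m}
    (hT : T ∈ quaternionic p) : ∃ q : Matrix (Fin 2) (Fin 2) ℂ, q.trace = 0 ∧
      qᴴ * leftWeight (coord p) = -(leftWeight (coord p) * q) ∧
      ∀ X, mat (T X) = q * mat X := by
  obtain ⟨g, rfl, q, hq, htr, hTq⟩ := hT
  have p1 : leftWeight (coord (g : Space m)) = blockA g * (blockA g)ᴴ := (one_sub_coord_mul g).1
  have hu := (Matrix.isUnit_iff_isUnit_det _).1 (isUnit_blockD g)
  have ha := (Matrix.isUnit_iff_isUnit_det _).1 (isUnit_blockA g)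
  have haH : IsUnit ((blockA g)ᴴ).det := by
    rw [Matrix.det_conjTranspose]
    exact ha.star
  have l2 := (Matrix.inv_eq_right_inv (blockA_conjTranspose_mul g)).symm
  have ht : ∀ Y, mat (translate g Y) = ((blockA g)ᴴ)⁻¹ * mat Y * (blockD g)⁻¹ := by
    intro Y
    rw [translate_apply, l2]
    rfl
  rw [p1]
  generalize blockA g = A at ha haH ht
  generalize blockD g = D at hu ht
  -- Translation is `X ↦ (Aᴴ)⁻¹ X D⁻¹`, so it carries left multiplication by `q` to left
  -- multiplication by this conjugate.
  refine ⟨(Aᴴ)⁻¹ * q * Aᴴ, ?_, ?_, ?_⟩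
  · rw [Matrix.trace_mul_comm, Matrix.mul_nonsing_inv_cancel_left _ _ haH, htr]
  · simp only [Matrix.conjTranspose_mul, Matrix.conjTranspose_nonsing_inv,
      Matrix.conjTranspose_conjTranspose, hq, Matrix.mul_assoc]
    rw [Matrix.nonsing_inv_mul_cancel_left _ _ ha, Matrix.mul_nonsing_inv_cancel_left _ _ haH]
    simp
  · intro X
    have hX : translate g (vec (Aᴴ * mat X * D)) = X := by
      have : mat (translate g (vec (Aᴴ * mat X * D))) = mat X := by
        rw [ht, mat_vec, Matrix.mul_assoc Aᴴ,
          Matrix.nonsing_inv_mul_cancel_left _ _ haH, Matrix.mul_assoc,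
          Matrix.mul_nonsing_inv _ hu, Matrix.mul_one]
      exact Matrix.of.injective this
    have h := hTq (vec (Aᴴ * mat X * D))
    rw [hX] at h
    rw [h, ht, mat_vec, mat_vec]
    simp only [Matrix.mul_assoc]
    rw [Matrix.mul_nonsing_inv _ hu, Matrix.mul_one]

/-! ### The curvature as a quartic invariant, and its expression through a canonical basis -/

/-- The `2 × 2` matrix whose trace is the Hermitian form. -/
def formMat (W X Y : Coord m) : Matrix (Fin 2) (Fin 2) ℂ :=
  mat X * rightWeight W * (mat Y)ᴴ * leftWeight W

/-- The quartic invariant of the isotropy representation. -/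
def quartic (W X Y Z V : Coord m) : ℂ := (formMat W X Y * formMat W Z V).trace

lemma trace_formMat (W X Y : Coord m) : (formMat W X Y).trace = form W X Y := by
  rw [formMat, Matrix.trace_mul_comm, form]
  simp only [Matrix.mul_assoc]

lemma quartic_comm (W X Y Z V : Coord m) : quartic W X Y Z V = quartic W Z V X Y :=
  Matrix.trace_mul_comm _ _

lemma star_quartic (W X Y Z V : Coord m) : star (quartic W X Y Z V) = quartic W Y X V Z := by
  have h : ∀ X Y : Coord m,
      (formMat W X Y)ᴴ = leftWeight W * (mat Y * rightWeight W * (mat X)ᴴ) := fun X Y => by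
    simp only [formMat, Matrix.conjTranspose_mul, Matrix.conjTranspose_conjTranspose,
      conjTranspose_leftWeight, conjTranspose_rightWeight, Matrix.mul_assoc]
  rw [quartic, ← Matrix.trace_conjTranspose, Matrix.conjTranspose_mul, h, h,
    Matrix.mul_assoc, Matrix.trace_mul_comm, quartic_comm, quartic]
  simp only [formMat, Matrix.mul_assoc]

lemma formMat_smul_left (W : Coord m) (c : ℂ) (X Y : Coord m) :
    formMat W (c • X) Y = c • formMat W X Y := by
  have h : mat (c • X) = c • mat X := rfl
  simp only [formMat, h, Matrix.smul_mul]

lemma quartic_smul (W : Coord m) (c : ℂ) (X Y Z V : Coord m) :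
    quartic W (c • X) Y Z V = c * quartic W X Y Z V := by
  rw [quartic, formMat_smul_left, Matrix.smul_mul, Matrix.trace_smul, smul_eq_mul, quartic]

/-- Each of the four summands of `curv W X Y Z`, inserted into `formMat W · V`, is already a product
of two matrices of the form `formMat`. -/
lemma form_curv (W X Y Z V : Coord m) :
    form W (curv W X Y Z) V = quartic W Y X Z V - quartic W X Y Z V
      + quartic W Z X Y V - quartic W Z Y X V := by
  simp only [← trace_formMat, quartic]
  simp only [← Matrix.trace_add, ← Matrix.trace_sub]
  congr 1
  simp only [formMat, curv, mat, vec, Equiv.apply_symm_apply,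
    Matrix.add_mul, Matrix.mul_sub, Matrix.sub_mul, Matrix.mul_assoc]
  abel

/-- The curvature component that enters the exterior derivative. -/
lemma metric_curv (W X Y N : Coord m) :
    metric W (curv W X Y N) (kaehler N) =
      -2 * (quartic W X Y N N).im - 2 * (quartic W X N N Y).im := by
  have h1 := congrArg Complex.im (star_quartic W X Y N N)
  have h2 := congrArg Complex.im (star_quartic W X N N Y)
  rw [metric_eq_re_form, kaehler_apply, form_smul_right, form_curv, quartic_comm W N Y X N,
    ← star_quartic W X Y N N, ← star_quartic W X N N Y]
  simp
  ring

/-- For `X = -JN` both quartic terms of `metric_curv` acquire a factor `-i` and become equal, so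
imaginary parts turn into one real part. These are the values that enter `dα`. -/
lemma metric_curv_reeb (W Y N : Coord m) :
    metric W (curv W (-kaehler N) Y N) (kaehler N) = 4 * (quartic W Y N N N).re := by
  have h : -kaehler N = (-Complex.I) • N := by rw [neg_smul]; rfl
  rw [metric_curv, h, quartic_smul, quartic_smul, ← star_quartic W Y N N N,
    quartic_comm W N N N Y, ← star_quartic W Y N N N]
  simp
  ring

lemma form_mul_left {W X X' : Coord m} {q : Matrix (Fin 2) (Fin 2) ℂ} (h : mat X' = q * mat X)
    (Y : Coord m) : form W X' Y = (q * formMat W X Y).trace := by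
  rw [← trace_formMat, formMat, h, formMat]
  simp only [Matrix.mul_assoc]

/-- Skewness of `q` for `P` gives skewness for the whole complex form, not only for its real part;
the imaginary parts are needed as well. -/
lemma form_mul_skew {W X X' Y Y' : Coord m} {q : Matrix (Fin 2) (Fin 2) ℂ}
    (hq : qᴴ * leftWeight W = -(leftWeight W * q)) (hX : mat X' = q * mat X)
    (hY : mat Y' = q * mat Y) : form W X' Y = -form W X Y' := by
  rw [form_mul_left hX, ← trace_formMat, formMat, formMat, hY, Matrix.conjTranspose_mul,
    ← Matrix.mul_assoc _ _ qᴴ, Matrix.mul_assoc _ qᴴ, hq, Matrix.trace_mul_comm]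
  simp only [Matrix.mul_assoc, Matrix.mul_neg, Matrix.trace_neg, neg_neg]

/-- The completeness relation of a canonical basis. -/
lemma IsCanonicalBasis.exists_matrices (hm : 0 < m) {p : Space m}
    {Jq : Fin 3 → Coord m →ₗ[ℝ] Coord m} (hJ : IsCanonicalBasis p Jq) :
    (∀ ν X Y, form (coord p) (Jq ν X) Y = -form (coord p) X (Jq ν Y)) ∧
    (∀ ν X, Jq ν (kaehler X) = kaehler (Jq ν X)) ∧
    ∀ X Y Z V, ∑ ν, form (coord p) (Jq ν X) Y * form (coord p) (Jq ν Z) V =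
      form (coord p) X Y * form (coord p) Z V - 2 * quartic (coord p) X Y Z V := by
  choose q htr hskew hq using fun ν => exists_matrix_of_mem_quaternionic (hJ.mem ν)
  -- Left multiplication is faithful as soon as there is one column to test on. This transfers the
  -- quaternion relations from the `J_ν` to the `2 × 2` matrices.
  have hext : ∀ a b : Matrix (Fin 2) (Fin 2) ℂ,
      (∀ X : Coord m, a * mat X = b * mat X) → a = b := by
    intro a b h
    ext i j
    have := congrFun (congrFun (h (vec (Matrix.single j ⟨0, hm⟩ 1))) i) ⟨0, hm⟩
    rw [mat_vec, Matrix.mul_single_apply_same, Matrix.mul_single_apply_same] at this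
    simpa using this
  have hsq : ∀ ν, q ν * q ν = -1 := fun ν => hext _ _ fun X => by
    rw [Matrix.mul_assoc, ← hq, ← hq, hJ.sq, Matrix.neg_mul, Matrix.one_mul]
    rfl
  have hmul : ∀ ν, q ν * q (ν + 1) = q (ν + 2) := fun ν => hext _ _ fun X => by
    rw [Matrix.mul_assoc, ← hq, ← hq, hJ.mul, hq]
  have hrev : ∀ ν, q (ν + 1) * q ν = -q (ν + 2) := fun ν => hext _ _ fun X => by
    rw [Matrix.mul_assoc, ← hq, ← hq, hJ.mul_rev, Matrix.neg_mul, ← hq]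
    rfl
  refine ⟨fun ν X Y => form_mul_skew (hskew ν) (hq ν X) (hq ν Y), fun ν X => ?_,
    fun X Y Z V => ?_⟩
  · apply Matrix.of.injective
    have h : ∀ X : Coord m, mat (kaehler X) = Complex.I • mat X := fun X => rfl
    change mat _ = mat _
    rw [hq, h, h, hq, Matrix.mul_smul]
  have := sum_trace_mul_trace (sum_mul_mul htr hsq hmul hrev)
    (formMat (coord p) X Y) (formMat (coord p) Z V)
  rw [trace_formMat, trace_formMat] at this
  rw [quartic, ← this]
  exact Finset.sum_congr rfl fun ν _ => by
    rw [form_mul_left (hq ν X), form_mul_left (hq ν Z)]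

/-- The sum over a canonical basis in terms of the curvature. -/
lemma sum_canonicalBasis (hm : 0 < m) {p : Space m} {Jq : Fin 3 → Coord m →ₗ[ℝ] Coord m}
    (hJ : IsCanonicalBasis p Jq) {W X Y N : Coord m} (hW : W = coord p) (hN : metric W N N = 1)
    (hX : metric W X N = 0) (hY : metric W Y N = 0) :
    ∑ ν, (metric W (Jq ν X) N
          * metric W (Jq ν (kaehler Y - metric W (kaehler Y) N • N)) N
        - metric W (Jq ν Y) N * metric W (Jq ν (kaehler X - metric W (kaehler X) N • N)) N
        - metric W (Jq ν X) Y * metric W (Jq ν (-kaehler N)) N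
        - 2 * metric W (kaehler X) N
          * metric W (Jq ν (kaehler Y - metric W (kaehler Y) N • N)) N
          * metric W (Jq ν (-kaehler N)) N
        + 2 * metric W (kaehler Y) N
          * metric W (Jq ν (kaehler X - metric W (kaehler X) N • N)) N
          * metric W (Jq ν (-kaehler N)) N) =
      metric W (kaehler X) Y - metric W (curv W X Y N) (kaehler N)
        + metric W (kaehler X) N * metric W (curv W (-kaehler N) Y N) (kaehler N)
        - metric W (kaehler Y) N * metric W (curv W (-kaehler N) X N) (kaehler N) := by
  subst hW
  obtain ⟨hskew, hcomm, hF⟩ := hJ.exists_matrices hm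
  set W := coord p
  have hNN : form W N N = 1 := by
    have := star_form W N N
    apply Complex.ext hN
    have := congrArg Complex.im this
    simp only [RCLike.star_def, Complex.conj_im] at this
    simp only [Complex.one_im]
    linarith
  -- `h(J_ν N, N)` is purely imaginary. Hence the normal component subtracted in `φ Z` does not
  -- contribute to `η_ν(φ Z)` (`hphi`), and `η_ν(ξ)` is the imaginary part (`hxi`).
  have hre : ∀ ν, (form W (Jq ν N) N).re = 0 := fun ν => by
    have h1 : form W (Jq ν N) N = -star (form W (Jq ν N) N) := by
      rw [star_form, ← hskew]
    have := congrArg Complex.re h1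
    simp only [RCLike.star_def, Complex.conj_re, Complex.neg_re] at this
    linarith
  have hJre : ∀ X Y, metric W (kaehler X) Y = -(form W X Y).im := fun X Y => by
    rw [metric_eq_re_form, kaehler_apply, form_smul_left]
    simp
  have hphi : ∀ ν Z, metric W (Jq ν (kaehler Z - metric W (kaehler Z) N • N)) N =
      -(form W (Jq ν Z) N).im := fun ν Z => by
    rw [map_sub, map_smul, hcomm, metric_sub_left, metric_smul_left, hJre,
      metric_eq_re_form W (Jq ν N), hre]
    ring
  have hxi : ∀ ν, metric W (Jq ν (-kaehler N)) N = (form W (Jq ν N) N).im := fun ν => by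
    rw [map_neg, hcomm, metric_neg_left, hJre, neg_neg]
  -- The Fierz instances: `f1` yields the two products of `η_ν` with `η_ν ∘ φ`, `f2` the term with
  -- `φ_ν`, and `f3`, `f4`, weighted by `η(X)` and `η(Y)`, the last two terms.
  have f1 := congrArg Complex.im (hF X N N Y)
  have f2 := congrArg Complex.im (hF X Y N N)
  have f3 := congrArg Complex.re (hF Y N N N)
  have f4 := congrArg Complex.re (hF X N N N)
  have g1 : ∀ ν, form W (Jq ν N) Y = -star (form W (Jq ν Y) N) := fun ν => by
    rw [hskew, star_form]
  simp only [hphi, hxi]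
  rw [metric_curv_reeb, metric_curv_reeb, metric_curv]
  simp only [hJre]
  rw [metric_eq_re_form] at hX hY
  simp only [metric_eq_re_form]
  rw [← star_form W Y N] at f1
  simp only [Fin.sum_univ_three, g1, hNN, Complex.add_im, Complex.add_re, Complex.mul_im,
    Complex.mul_re, Complex.sub_im, Complex.sub_re, Complex.neg_im, Complex.neg_re, RCLike.star_def,
    Complex.conj_re, Complex.conj_im, hre, hX, hY, Complex.one_re, Complex.one_im, Complex.re_ofNat,
    Complex.im_ofNat] at f1 f2 f3 f4 ⊢
  linear_combination -f1 - f2 + 2 * (form W X N).im * f3 - 2 * (form W Y N).im * f4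

end Quaternionic

/-! ### Reading functions and vector fields in a chart -/

section ManifoldChart

lemma contMDiffAt_of_chart {n : ℕ} {M : Type*} [TopologicalSpace M]
    [ChartedSpace (EuclideanSpace ℝ (Fin n)) M] {F : Type*}
    [NormedAddCommGroup F] [NormedSpace ℝ F] {x : M} {h : M → F} {k : WithTop ℕ∞} (hk : k ≤ ∞)
    (hh : ContDiffAt ℝ k (fun z => h ((extChartAt (𝓡 n) x).symm z)) (extChartAt (𝓡 n) x x)) :
    ContMDiffAt (𝓡 n) 𝓘(ℝ, F) k h x := by
  have h1 : ContMDiffAt (𝓡 n) 𝓘(ℝ, EuclideanSpace ℝ (Fin n)) ∞ (extChartAt (𝓡 n) x) x :=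
    contMDiffAt_extChartAt
  refine (hh.contMDiffAt.comp x (h1.of_le hk)).congr_of_eventuallyEq ?_
  filter_upwards [extChartAt_source_mem_nhds (I := 𝓡 n) x] with y hy
  exact congrArg h ((extChartAt (𝓡 n) x).left_inv hy).symm

variable {n : ℕ} {M : Type*} [TopologicalSpace M] [ChartedSpace (EuclideanSpace ℝ (Fin n)) M]
  [IsManifold (𝓡 n) ∞ M] {F : Type*} [NormedAddCommGroup F] [NormedSpace ℝ F]
  {x : M} {u : EuclideanSpace ℝ (Fin n)} {h : M → F}

/-- The derivative of the inverse of the chart at `x`. -/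
def chartDeriv (x : M) (u : EuclideanSpace ℝ (Fin n)) :
    EuclideanSpace ℝ (Fin n) →L[ℝ] TangentSpace (𝓡 n) ((extChartAt (𝓡 n) x).symm u) :=
  mfderivWithin 𝓘(ℝ, EuclideanSpace ℝ (Fin n)) (𝓡 n) (extChartAt (𝓡 n) x).symm
    (Set.range (𝓡 n)) u

/-- The derivative of the chart at `x`. -/
def chartMap (x y : M) : TangentSpace (𝓡 n) y →L[ℝ] EuclideanSpace ℝ (Fin n) :=
  mfderiv (𝓡 n) 𝓘(ℝ, EuclideanSpace ℝ (Fin n)) (extChartAt (𝓡 n) x) y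

lemma chartMap_chartDeriv (hu : u ∈ (extChartAt (𝓡 n) x).target)
    (v : EuclideanSpace ℝ (Fin n)) :
    chartMap x ((extChartAt (𝓡 n) x).symm u) (chartDeriv x u v) = v :=
  DFunLike.congr_fun (mfderiv_extChartAt_comp_mfderivWithin_extChartAt_symm hu) v

lemma chartDeriv_chartMap (hu : u ∈ (extChartAt (𝓡 n) x).target)
    (Y : TangentSpace (𝓡 n) ((extChartAt (𝓡 n) x).symm u)) :
    chartDeriv x u (chartMap x ((extChartAt (𝓡 n) x).symm u) Y) = Y :=
  DFunLike.congr_fun (mfderivWithin_extChartAt_symm_comp_mfderiv_extChartAt hu) Y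

lemma isInvertible_chartDeriv (hu : u ∈ (extChartAt (𝓡 n) x).target) :
    (chartDeriv x u).IsInvertible :=
  isInvertible_mfderivWithin_extChartAt_symm hu

lemma fderiv_comp_chart (hu : u ∈ (extChartAt (𝓡 n) x).target)
    (hh : MDifferentiableAt (𝓡 n) 𝓘(ℝ, F) h ((extChartAt (𝓡 n) x).symm u))
    (v : EuclideanSpace ℝ (Fin n)) :
    fderiv ℝ (fun z => h ((extChartAt (𝓡 n) x).symm z)) u v =
      mvfderiv (𝓡 n) h ((extChartAt (𝓡 n) x).symm u) (chartDeriv x u v) := by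
  have h1 := mfderiv_comp_mfderivWithin (I := 𝓘(ℝ, EuclideanSpace ℝ (Fin n))) (I' := 𝓡 n)
    (I'' := 𝓘(ℝ, F)) (g := h) (f := (extChartAt (𝓡 n) x).symm) (s := Set.range (𝓡 n)) u hh
    (mdifferentiableWithinAt_extChartAt_symm hu)
    ((𝓡 n).uniqueMDiffOn u (extChartAt_target_subset_range x hu))
  have h2 : mfderivWithin 𝓘(ℝ, EuclideanSpace ℝ (Fin n)) 𝓘(ℝ, F)
      (h ∘ (extChartAt (𝓡 n) x).symm) (Set.range (𝓡 n)) u =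
      fderiv ℝ (fun z => h ((extChartAt (𝓡 n) x).symm z)) u := by
    rw [mfderivWithin_eq_fderivWithin, (𝓡 n).range_eq_univ, fderivWithin_univ]
    rfl
  rw [← h2, h1]
  rfl

lemma contDiffAt_comp_chart {k : WithTop ℕ∞} (hk : k ≤ ∞)
    (hu : u ∈ (extChartAt (𝓡 n) x).target)
    (hh : ContMDiffAt (𝓡 n) 𝓘(ℝ, F) k h ((extChartAt (𝓡 n) x).symm u)) :
    ContDiffAt ℝ k (fun z => h ((extChartAt (𝓡 n) x).symm z)) u := by
  have h1 : ContMDiffAt 𝓘(ℝ, EuclideanSpace ℝ (Fin n)) (𝓡 n) ∞ (extChartAt (𝓡 n) x).symm u :=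
    (contMDiffOn_extChartAt_symm x).contMDiffAt
      ((isOpen_extChartAt_target x).mem_nhds hu)
  exact (hh.comp u (h1.of_le hk)).contDiffAt

/-- A vector field read in the chart at `x`. -/
def chartField (x : M) (V : Π y : M, TangentSpace (𝓡 n) y) (u : EuclideanSpace ℝ (Fin n)) :
    EuclideanSpace ℝ (Fin n) :=
  (chartDeriv x u).inverse (V ((extChartAt (𝓡 n) x).symm u))

lemma chartDeriv_chartField (V : Π y : M, TangentSpace (𝓡 n) y)
    (hu : u ∈ (extChartAt (𝓡 n) x).target) :
    chartDeriv x u (chartField x V u) = V ((extChartAt (𝓡 n) x).symm u) := by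
  obtain ⟨e, he⟩ := isInvertible_chartDeriv (x := x) hu
  rw [chartField, ← he, ContinuousLinearMap.inverse_equiv]
  exact e.apply_symm_apply _

lemma contDiffAt_chartField {V : Π y : M, TangentSpace (𝓡 n) y}
    (hV : ContMDiffAt (𝓡 n) (𝓡 n).tangent ∞
      (fun y => (⟨y, V y⟩ : TangentBundle (𝓡 n) M)) x) :
    ContDiffAt ℝ 1 (chartField x V) (extChartAt (𝓡 n) x x) := by
  have h1 := VectorField.contMDiffWithinAt_mpullbackWithin_extChartAt_symm (n := ∞) (m := 1)
    (s := Set.univ) (V := V) ((hV.of_le (by norm_num)).contMDiffWithinAt) uniqueMDiffOn_univ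
    (Set.mem_univ x) (by norm_num; exact WithTop.coe_le_coe.2 (le_top : (2 : ℕ∞) ≤ ⊤))
  rw [contMDiffWithinAt_vectorSpace_iff_contDiffWithinAt] at h1
  refine h1.contDiffAt ?_
  simp only [Set.preimage_univ, Set.inter_univ]
  exact extChartAt_target_mem_nhds x

lemma mvfderiv_eq_fderiv_chart (hh : MDifferentiableAt (𝓡 n) 𝓘(ℝ, F) h x)
    (X : TangentSpace (𝓡 n) x) :
    mvfderiv (𝓡 n) h x X =
      fderiv ℝ (fun z => h ((extChartAt (𝓡 n) x).symm z)) (extChartAt (𝓡 n) x x)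
        (chartMap x x X) := by
  -- The type of a tangent vector depends on its base point. Generalizing to all `y` in the chart
  -- domain lets `y` be replaced by the image of a coordinate point without transporting `X`.
  have key : ∀ y (Y : TangentSpace (𝓡 n) y), y ∈ (extChartAt (𝓡 n) x).source →
      MDifferentiableAt (𝓡 n) 𝓘(ℝ, F) h y →
      mvfderiv (𝓡 n) h y Y =
        fderiv ℝ (fun z => h ((extChartAt (𝓡 n) x).symm z)) (extChartAt (𝓡 n) x y)
          (chartMap x y Y) := by
    intro y Y hy hhy
    obtain ⟨u, hu, rfl⟩ : ∃ u ∈ (extChartAt (𝓡 n) x).target, (extChartAt (𝓡 n) x).symm u = y :=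
      ⟨extChartAt (𝓡 n) x y, (extChartAt (𝓡 n) x).map_source hy,
        (extChartAt (𝓡 n) x).left_inv hy⟩
    rw [(extChartAt (𝓡 n) x).right_inv hu, fderiv_comp_chart hu hhy]
    rw [chartDeriv_chartMap hu]
  exact key x X (mem_extChartAt_source x) hh

lemma chartField_self (V : Π y : M, TangentSpace (𝓡 n) y) :
    chartField x V (extChartAt (𝓡 n) x x) =
      chartMap x x (V x) := by
  have hu := mem_extChartAt_target (I := 𝓡 n) x
  have h1 := chartMap_chartDeriv hu (chartField x V (extChartAt (𝓡 n) x x))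
  have h2 := chartDeriv_chartField V hu
  have key : ∀ y, y = x →
      chartMap x y (V y) =
        chartMap x x (V x) := by
    rintro _ rfl; rfl
  rw [← key _ ((extChartAt (𝓡 n) x).left_inv (mem_extChartAt_source x)), ← h2]
  exact h1.symm

/-- The bracket on `M` is the pullback of the coordinate bracket by the chart, and the inverse of
the chart derivative cancels. Applied to the immersion, it makes the torsion-free identity available
for the bracket terms of the Koszul formula. -/
lemma mvfderiv_mlieBracket {V W : Π y : M, TangentSpace (𝓡 n) y}
    (hh : MDifferentiableAt (𝓡 n) 𝓘(ℝ, F) h x) :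
    mvfderiv (𝓡 n) h x (VectorField.mlieBracket (𝓡 n) V W x) =
      fderiv ℝ (fun z => h ((extChartAt (𝓡 n) x).symm z)) (extChartAt (𝓡 n) x x)
        (VectorField.lieBracket ℝ (chartField x V) (chartField x W) (extChartAt (𝓡 n) x x)) := by
  have e : VectorField.mlieBracket (𝓡 n) V W x =
      (chartMap x x).inverse
        (VectorField.lieBracket ℝ (chartField x V) (chartField x W) (extChartAt (𝓡 n) x x)) := by
    have e' : VectorField.mlieBracket (𝓡 n) V W x = (chartMap x x).inverse
        (VectorField.lieBracketWithin ℝ (chartField x V) (chartField x W)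
          ((extChartAt (𝓡 n) x).symm ⁻¹' Set.univ ∩ Set.range (𝓡 n)) (extChartAt (𝓡 n) x x)) :=
      VectorField.mlieBracketWithin_apply
    rw [e', Set.preimage_univ, Set.univ_inter, (𝓡 n).range_eq_univ,
      VectorField.lieBracketWithin_univ]
  obtain ⟨i, hi⟩ : (chartMap (n := n) x x).IsInvertible :=
    isInvertible_mfderiv_extChartAt (mem_extChartAt_source x)
  rw [mvfderiv_eq_fderiv_chart hh, e, ← hi, ContinuousLinearMap.inverse_equiv]
  exact congrArg _ (i.apply_symm_apply _)

end ManifoldChart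

/-- A dimension count: `(X, s) ↦ L X + s N` is injective, since pairing with `N` recovers `s`, and
both sides have real dimension `4 m`. -/
lemma exists_tangent_add_normal {m : ℕ} {E : Type*} [AddCommGroup E] [Module ℝ E]
    [FiniteDimensional ℝ E] (hE : Module.finrank ℝ E + 1 = 4 * m) {p : Space m}
    {L : E →ₗ[ℝ] Coord m} (hL : Function.Injective L) {N : Coord m}
    (hN : metric (coord p) N N = 1) (hLN : ∀ X, metric (coord p) (L X) N = 0) (v : Coord m) :
    ∃ X, v = L X + metric (coord p) v N • N := by
  let T : E × ℝ →ₗ[ℝ] Coord m := L.coprod (LinearMap.toSpanSingleton ℝ (Coord m) N)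
  have hT : ∀ X s, T (X, s) = L X + s • N := fun X s => by simp [T]
  have hm : ∀ X s, metric (coord p) (T (X, s)) N = s := fun X s => by
    rw [hT, metric_add_left, hLN, metric_smul_left, hN]; ring
  have hinj : Function.Injective T := by
    rw [← LinearMap.ker_eq_bot, LinearMap.ker_eq_bot']
    rintro ⟨X, s⟩ h
    have hs := hm X s
    rw [h, metric_zero_left] at hs
    rw [hT, ← hs, zero_smul, add_zero] at h
    rw [← hs, hL (h.trans (map_zero L).symm)]
    rfl
  have hdim : Module.finrank ℝ (E × ℝ) = Module.finrank ℝ (Coord m) := by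
    rw [Module.finrank_prod, Module.finrank_self, hE, Module.finrank_pi_fintype]
    simp only [Module.finrank_pi_fintype, Complex.finrank_real_complex, Finset.sum_const,
      Finset.card_univ, Fintype.card_fin, smul_eq_mul]
    ring
  obtain ⟨⟨X, s⟩, hX⟩ := (LinearMap.injective_iff_surjective_of_finrank_eq_finrank hdim).1 hinj v
  refine ⟨X, ?_⟩
  have := hm X s
  rw [hX] at this
  rw [this, ← hT, hX]

/-! ### Tangential projection and the second fundamental form of the hypersurface -/

namespace OrientedHypersurface

variable {m : ℕ} {M : Type*} [TopologicalSpace M]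
  [ChartedSpace (EuclideanSpace ℝ (Fin (4 * m - 1))) M] (S : OrientedHypersurface m M)

section Pointwise

lemma diff_tangential (hm : 0 < m) (x : M) (v : Coord m) :
    S.diff x (S.tangential x v) = v - S.ambient x v (S.normal x) • S.normal x := by
  let L : EuclideanSpace ℝ (Fin (4 * m - 1)) →ₗ[ℝ] Coord m := (S.diff x).toLinearMap
  -- A decomposition exists, so the chosen tangent vector is one. Positivity of `m` is what makes
  -- `(4 * m - 1) + 1 = 4 * m` true for the truncated subtraction.
  have h : v = S.diff x (S.tangential x v) + S.ambient x v (S.normal x) • S.normal x :=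
    Classical.epsilon_spec (p := fun X => v = S.diff x X + S.ambient x v (S.normal x) • S.normal x)
      (exists_tangent_add_normal (by rw [finrank_euclideanSpace_fin]; omega) (L := L)
        (S.immersion x) (S.normal_unit x) (S.normal_orthogonal x) v)
  exact eq_sub_of_add_eq h.symm

lemma diff_injective (x : M) : Function.Injective (S.diff x) := S.immersion x

lemma metric_diff_normal (x : M) (X : TangentSpace (𝓡 (4 * m - 1)) x) :
    metric (coord (S.toFun x)) (S.diff x X) (S.normal x) = 0 := S.normal_orthogonal x X

lemma metric_kaehler_self (W N : Coord m) : metric W (kaehler N) N = 0 := by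
  have := metric_kaehler_left W N N
  rw [metric_comm W N] at this
  linarith

lemma diff_reeb (hm : 0 < m) (x : M) : S.diff x (S.reeb x) = -kaehler (S.normal x) := by
  rw [reeb, S.diff_tangential hm, ambient, metric_neg_left, metric_kaehler_self]
  simp

lemma diff_phi (hm : 0 < m) (x : M) (T : Coord m →ₗ[ℝ] Coord m)
    (X : TangentSpace (𝓡 (4 * m - 1)) x) :
    S.diff x (S.phi x T X) = T (S.diff x X)
      - metric (coord (S.toFun x)) (T (S.diff x X)) (S.normal x) • S.normal x :=
  S.diff_tangential hm x _

lemma ambientCov_eq (V : M → Coord m) (x : M) (X : TangentSpace (𝓡 (4 * m - 1)) x) :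
    S.ambientCov V x X = mvfderiv (𝓡 (4 * m - 1)) V x X
      + gam (coord (S.toFun x)) (S.diff x X) (V x) := by
  rw [ambientCov, christoffel_eq_gam]

end Pointwise

section Local

variable (x : M)

/-- The immersion read in the chart at `x`. -/
def chartFun (u : EuclideanSpace ℝ (Fin (4 * m - 1))) : Coord m :=
  coord (S.toFun ((extChartAt (𝓡 (4 * m - 1)) x).symm u))

/-- The normal field read in the chart at `x`. -/
def chartNormal (u : EuclideanSpace ℝ (Fin (4 * m - 1))) : Coord m :=
  S.normal ((extChartAt (𝓡 (4 * m - 1)) x).symm u)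

variable {x} {u : EuclideanSpace ℝ (Fin (4 * m - 1))}

lemma regular_chartFun (u : EuclideanSpace ℝ (Fin (4 * m - 1))) : Regular (S.chartFun x u) :=
  regular_coord _

lemma mdifferentiableAt_coord (y : M) :
    MDifferentiableAt (𝓡 (4 * m - 1)) 𝓘(ℝ, Coord m) (fun z => coord (S.toFun z)) y :=
  S.smooth.contMDiffAt.mdifferentiableAt (by simp)

lemma mdifferentiableAt_normal (y : M) :
    MDifferentiableAt (𝓡 (4 * m - 1)) 𝓘(ℝ, Coord m) S.normal y :=
  S.smooth_normal.contMDiffAt.mdifferentiableAt (by simp)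

lemma chartFun_self : S.chartFun x (extChartAt (𝓡 (4 * m - 1)) x x) = coord (S.toFun x) := by
  rw [chartFun, extChartAt_to_inv]

lemma chartNormal_self : S.chartNormal x (extChartAt (𝓡 (4 * m - 1)) x x) = S.normal x := by
  rw [chartNormal, extChartAt_to_inv]

variable [IsManifold (𝓡 (4 * m - 1)) ∞ M]

lemma contDiffAt_chartFun (hu : u ∈ (extChartAt (𝓡 (4 * m - 1)) x).target) :
    ContDiffAt ℝ ∞ (S.chartFun x) u :=
  contDiffAt_comp_chart le_rfl hu S.smooth.contMDiffAt

lemma contDiffAt_chartNormal (hu : u ∈ (extChartAt (𝓡 (4 * m - 1)) x).target) :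
    ContDiffAt ℝ ∞ (S.chartNormal x) u :=
  contDiffAt_comp_chart le_rfl hu S.smooth_normal.contMDiffAt

lemma diff_chartDeriv (hu : u ∈ (extChartAt (𝓡 (4 * m - 1)) x).target)
    (v : EuclideanSpace ℝ (Fin (4 * m - 1))) :
    S.diff ((extChartAt (𝓡 (4 * m - 1)) x).symm u) (chartDeriv x u v) =
      fderiv ℝ (S.chartFun x) u v :=
  (fderiv_comp_chart hu (S.mdifferentiableAt_coord _) v).symm

lemma ambientCov_chartDeriv (hu : u ∈ (extChartAt (𝓡 (4 * m - 1)) x).target)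
    (v : EuclideanSpace ℝ (Fin (4 * m - 1))) :
    S.ambientCov S.normal ((extChartAt (𝓡 (4 * m - 1)) x).symm u) (chartDeriv x u v) =
      cov (S.chartFun x) (S.chartNormal x) u v := by
  rw [ambientCov_eq, S.diff_chartDeriv hu, cov]
  congr 1
  exact (fderiv_comp_chart hu (S.mdifferentiableAt_normal _) v).symm

lemma diff_eq_fderiv (X : TangentSpace (𝓡 (4 * m - 1)) x) :
    S.diff x X =
      fderiv ℝ (S.chartFun x) (extChartAt (𝓡 (4 * m - 1)) x x) (chartMap x x X) :=
  mvfderiv_eq_fderiv_chart (S.mdifferentiableAt_coord x) X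

lemma ambientCov_eq_cov (X : TangentSpace (𝓡 (4 * m - 1)) x) :
    S.ambientCov S.normal x X = cov (S.chartFun x) (S.chartNormal x)
      (extChartAt (𝓡 (4 * m - 1)) x x) (chartMap x x X) := by
  rw [ambientCov_eq, S.diff_eq_fderiv, cov, S.chartFun_self, S.chartNormal_self,
    mvfderiv_eq_fderiv_chart (S.mdifferentiableAt_normal x) X]
  rfl

lemma metric_fderiv_chartNormal (hu : u ∈ (extChartAt (𝓡 (4 * m - 1)) x).target)
    (v : EuclideanSpace ℝ (Fin (4 * m - 1))) :
    metric (S.chartFun x u) (fderiv ℝ (S.chartFun x) u v) (S.chartNormal x u) = 0 := by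
  rw [← S.diff_chartDeriv hu]
  exact S.metric_diff_normal _ _

/-- Differentiate `g(N, N) = 1`. Hence no normal part is lost when the shape operator is projected
to the tangent space. -/
lemma metric_ambientCov_normal (x : M) (X : TangentSpace (𝓡 (4 * m - 1)) x) :
    metric (coord (S.toFun x)) (S.ambientCov S.normal x X) (S.normal x) = 0 := by
  have hu := mem_extChartAt_target (I := 𝓡 (4 * m - 1)) x
  have hN := (S.contDiffAt_chartNormal hu).of_le (m := 1) (by simp)
  have h := fderiv_metric ((S.contDiffAt_chartFun hu).of_le (m := 1) (by simp))
    (S.regular_chartFun _) hN hN (chartMap x x X)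
  have h1 : (fun w => metric (S.chartFun x w) (S.chartNormal x w) (S.chartNormal x w)) =
      fun _ => 1 := funext fun w => S.normal_unit _
  rw [h1, fderiv_fun_const, metric_comm _ (S.chartNormal x _), ← S.ambientCov_eq_cov,
    S.chartFun_self, S.chartNormal_self] at h
  simp only [Pi.zero_apply, zero_apply] at h
  linarith

/-- The second fundamental form is symmetric. -/
lemma metric_diff_ambientCov_comm (x : M) (X Y : TangentSpace (𝓡 (4 * m - 1)) x) :
    metric (coord (S.toFun x)) (S.diff x X) (S.ambientCov S.normal x Y) =
      metric (coord (S.toFun x)) (S.diff x Y) (S.ambientCov S.normal x X) := by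
  have hu := mem_extChartAt_target (I := 𝓡 (4 * m - 1)) x
  have hN := (S.contDiffAt_chartNormal hu).of_le (m := 1) (by simp)
  have hf2 := (S.contDiffAt_chartFun hu).of_le (m := 2) (WithTop.coe_le_coe.2 le_top)
  -- Differentiate `g(df(w), N) = 0` in the direction `v`; the second derivative term is symmetric
  -- in `v` and `w` because the connection is torsion free.
  have key : ∀ v w,
      metric (coord (S.toFun x)) (cov (S.chartFun x) (fun z => fderiv ℝ (S.chartFun x) z w)
          (extChartAt (𝓡 (4 * m - 1)) x x) v) (S.normal x)
        + metric (coord (S.toFun x)) (fderiv ℝ (S.chartFun x) (extChartAt (𝓡 (4 * m - 1)) x x) w)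
          (cov (S.chartFun x) (S.chartNormal x) (extChartAt (𝓡 (4 * m - 1)) x x) v) = 0 := by
    intro v w
    have h := fderiv_metric ((S.contDiffAt_chartFun hu).of_le (m := 1) (by simp))
      (S.regular_chartFun _)
      (V₁ := fun z => fderiv ℝ (S.chartFun x) z w)
      ((hf2.fderiv_right (m := 1) (by norm_num)).clm_apply contDiffAt_const) hN v
    have h1 : (fun z => metric (S.chartFun x z) (fderiv ℝ (S.chartFun x) z w)
        (S.chartNormal x z)) =ᶠ[nhds (extChartAt (𝓡 (4 * m - 1)) x x)] fun _ => 0 := by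
      filter_upwards [extChartAt_target_mem_nhds (I := 𝓡 (4 * m - 1)) x] with z hz
      exact S.metric_fderiv_chartNormal hz w
    rw [h1.fderiv_eq, fderiv_fun_const, S.chartFun_self, S.chartNormal_self] at h
    exact h.symm
  have k1 := key (chartMap x x X) (chartMap x x Y)
  have k2 := key (chartMap x x Y) (chartMap x x X)
  rw [← S.ambientCov_eq_cov, ← S.diff_eq_fderiv] at k1 k2
  rw [cov_fderiv_comm hf2] at k1
  linarith

lemma diff_shape (hm : 0 < m) (x : M) (X : TangentSpace (𝓡 (4 * m - 1)) x) :
    S.diff x (S.shape x X) = -S.ambientCov S.normal x X := by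
  rw [shape, S.diff_tangential hm, ambient, metric_neg_left, S.metric_ambientCov_normal]
  simp

end Local

end OrientedHypersurface

/-! ### From a geodesic Reeb flow to `A ξ = α ξ` -/

/-- The solution of an injective linear system with smooth coefficients is smooth. -/
lemma contDiffAt_of_clm_apply_eq {E F : Type*} [NormedAddCommGroup E] [NormedSpace ℝ E]
    [FiniteDimensional ℝ E] [NormedAddCommGroup F] [NormedSpace ℝ F] [FiniteDimensional ℝ F]
    {n : WithTop ℕ∞} {L : E → E →L[ℝ] F} {b : E → F} {ξ : E → E} {u : E}
    (hL : ContDiffAt ℝ n L u) (hb : ContDiffAt ℝ n b u) (hinj : Function.Injective (L u))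
    (h : ∀ᶠ z in nhds u, L z (ξ z) = b z) : ContDiffAt ℝ n ξ u := by
  have : CompleteSpace E := FiniteDimensional.complete ℝ E
  -- A left inverse `R` of `L u` makes `R L z` invertible near `u`, so there `ξ = (R L)⁻¹ R b`, and
  -- inversion is smooth.
  obtain ⟨R, hR⟩ := (L u).toLinearMap.exists_leftInverse_of_injective
    (LinearMap.ker_eq_bot.2 hinj)
  let R' : F →L[ℝ] E := LinearMap.toContinuousLinearMap R
  have hT : ContDiffAt ℝ n (fun z => R' ∘L L z) u := contDiffAt_const.clm_comp hL
  have hTu : R' ∘L L u = (ContinuousLinearEquiv.refl ℝ E : E →L[ℝ] E) := by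
    ext v
    exact DFunLike.congr_fun hR v
  have hinv : ContDiffAt ℝ n (fun z => (R' ∘L L z).inverse) u := by
    refine ContDiffAt.comp u (g := ContinuousLinearMap.inverse) ?_ hT
    rw [hTu]
    exact contDiffAt_map_inverse _
  have hev : ∀ᶠ z in nhds u, R' ∘L L z ∈ Set.range ((↑) : (E ≃L[ℝ] E) → E →L[ℝ] E) := by
    refine hT.continuousAt.eventually ?_
    change ∀ᶠ y in nhds (R' ∘L L u), _
    rw [hTu]
    exact ContinuousLinearEquiv.nhds _
  refine (hinv.clm_apply (R'.contDiff.contDiffAt.comp u hb)).congr_of_eventuallyEq ?_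
  filter_upwards [h, hev] with z hz ⟨e, he⟩
  have h1 : R' (b z) = e (ξ z) := by
    rw [← hz]
    exact (DFunLike.congr_fun he (ξ z)).symm
  change ξ z = (R' ∘L L z).inverse (R' (b z))
  rw [h1, ← he, ContinuousLinearMap.inverse_equiv]
  simp

section Bracket

variable {m : ℕ} {E : Type*} [NormedAddCommGroup E] [NormedSpace ℝ E] {f V V' : E → Coord m}
  {u : E}

lemma cov_congr (h : V =ᶠ[nhds u] V') (v : E) : cov f V u v = cov f V' u v := by
  rw [cov, cov, h.fderiv_eq, h.eq_of_nhds]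

/-- The connection along a map is torsion free. -/
lemma fderiv_lieBracket {ξ η : E → E} (hf : ContDiffAt ℝ 2 f u) (hξ : DifferentiableAt ℝ ξ u)
    (hη : DifferentiableAt ℝ η u) :
    fderiv ℝ f u (VectorField.lieBracket ℝ ξ η u) =
      cov f (fun z => fderiv ℝ f z (η z)) u (ξ u)
        - cov f (fun z => fderiv ℝ f z (ξ z)) u (η u) := by
  have hd : DifferentiableAt ℝ (fderiv ℝ f) u :=
    (hf.fderiv_right (m := 1) (by norm_num)).differentiableAt one_ne_zero
  rw [cov, cov, fderiv_clm_apply hd hη, fderiv_clm_apply hd hξ, VectorField.lieBracket,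
    gam_comm _ (fderiv ℝ f u (ξ u))]
  have := (hf.isSymmSndFDerivAt (by simp)).eq (ξ u) (η u)
  simp [this]

end Bracket

namespace OrientedHypersurface

variable {m : ℕ} {M : Type*} [TopologicalSpace M]
  [ChartedSpace (EuclideanSpace ℝ (Fin (4 * m - 1))) M] (S : OrientedHypersurface m M)
  [IsManifold (𝓡 (4 * m - 1)) ∞ M]

/-- If the Reeb flow is geodesic, then `∇̄_ξ N` is orthogonal to the image under `J` of the tangent
space. -/
lemma metric_kaehler_ambientCov_reeb (hm : 0 < m) (hS : S.GeodesicReebFlow) (x : M)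
    (X : TangentSpace (𝓡 (4 * m - 1)) x) :
    metric (coord (S.toFun x)) (kaehler (S.diff x X)) (S.ambientCov S.normal x (S.reeb x)) = 0 := by
  have hu := mem_extChartAt_target (I := 𝓡 (4 * m - 1)) x
  set u := extChartAt (𝓡 (4 * m - 1)) x x with hudef
  set f := S.chartFun x with hf
  set N := S.chartNormal x with hN
  have hf2 : ContDiffAt ℝ 2 f u :=
    (S.contDiffAt_chartFun hu).of_le (WithTop.coe_le_coe.2 le_top)
  have hf1 : ContDiffAt ℝ 1 f u := hf2.of_le (by norm_num)
  have hN1 : ContDiffAt ℝ 1 N u := (S.contDiffAt_chartNormal hu).of_le (by simp)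
  have hdf : ContDiffAt ℝ 1 (fderiv ℝ f) u := hf2.fderiv_right (by norm_num)
  let W : Π y : M, TangentSpace (𝓡 (4 * m - 1)) y :=
    FiberBundle.extend (EuclideanSpace ℝ (Fin (4 * m - 1))) X
  have hWx : W x = X := FiberBundle.extend_apply_self _ X
  have hW : ContMDiffAt (𝓡 (4 * m - 1)) (𝓡 (4 * m - 1)).tangent ∞
      (fun y => (⟨y, W y⟩ : TangentBundle (𝓡 (4 * m - 1)) M)) x :=
    FiberBundle.contMDiffAt_extend (𝓡 (4 * m - 1)) (EuclideanSpace ℝ (Fin (4 * m - 1))) X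
  set η := chartField x W
  set ξ := chartField x S.reeb
  have hη1 : ContDiffAt ℝ 1 η u := contDiffAt_chartField hW
  have hfield : ∀ (V : Π y : M, TangentSpace (𝓡 (4 * m - 1)) y) z,
      z ∈ (extChartAt (𝓡 (4 * m - 1)) x).target → fderiv ℝ f z (chartField x V z) =
        S.diff ((extChartAt (𝓡 (4 * m - 1)) x).symm z)
          (V ((extChartAt (𝓡 (4 * m - 1)) x).symm z)) := by
    intro V z hz
    rw [hf, ← S.diff_chartDeriv hz, chartDeriv_chartField V hz]
  have hxi : ∀ z ∈ (extChartAt (𝓡 (4 * m - 1)) x).target,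
      fderiv ℝ f z (ξ z) = -kaehler (N z) := fun z hz => by
    rw [hfield S.reeb z hz, S.diff_reeb hm]; rfl
  have htarget := extChartAt_target_mem_nhds (I := 𝓡 (4 * m - 1)) x
  have hb : ContDiffAt ℝ 1 (fun z => -kaehler (N z)) u := (hN1.const_smul Complex.I).neg
  have hinj : Function.Injective (fderiv ℝ f u) := by
    intro v w hvw
    rw [hf, ← S.diff_chartDeriv hu, ← S.diff_chartDeriv hu] at hvw
    have := congrArg (chartMap x _) (S.diff_injective _ hvw)
    rwa [chartMap_chartDeriv hu, chartMap_chartDeriv hu] at this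
  -- The Reeb field is defined by pointwise choice; its regularity comes from the linear system
  -- `df(ξ) = -JN`.
  have hξ1 : ContDiffAt ℝ 1 ξ u :=
    contDiffAt_of_clm_apply_eq hdf hb hinj (Filter.mem_of_superset htarget hxi)
  have hV : ContDiffAt ℝ 1 (fun z => fderiv ℝ f z (η z)) u := hdf.clm_apply hη1
  have hbr := fderiv_lieBracket hf2 (hξ1.differentiableAt one_ne_zero)
    (hη1.differentiableAt one_ne_zero)
  have hbe : (fun z => fderiv ℝ f z (ξ z)) =ᶠ[nhds u] fun z => -kaehler (N z) :=
    Filter.mem_of_superset htarget hxi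
  rw [cov_congr hbe] at hbr
  have hcb : ∀ v, cov f (fun z => -kaehler (N z)) u v = -kaehler (cov f N u v) := fun v => by
    have h1 : (fun z => -kaehler (N z)) = fun z => (-Complex.I) • N z :=
      funext fun z => (neg_smul _ _).symm
    rw [h1, cov_smul (-Complex.I) (hN1.differentiableAt one_ne_zero), neg_smul]
    rfl
  have hk : (fun z => S.g ((extChartAt (𝓡 (4 * m - 1)) x).symm z)
      (S.reeb ((extChartAt (𝓡 (4 * m - 1)) x).symm z))
      (W ((extChartAt (𝓡 (4 * m - 1)) x).symm z))) =ᶠ[nhds u]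
      fun z => metric (f z) (-kaehler (N z)) (fderiv ℝ f z (η z)) := by
    filter_upwards [htarget] with z hz
    rw [hfield W z hz, g, S.diff_reeb hm]
    rfl
  have hkd : ContDiffAt ℝ 1 (fun z => S.g ((extChartAt (𝓡 (4 * m - 1)) x).symm z)
      (S.reeb ((extChartAt (𝓡 (4 * m - 1)) x).symm z))
      (W ((extChartAt (𝓡 (4 * m - 1)) x).symm z))) u :=
    (contDiffAt_metric hf1 (S.regular_chartFun _) hb hV).congr_of_eventuallyEq hk
  have hkm : MDifferentiableAt (𝓡 (4 * m - 1)) 𝓘(ℝ, ℝ) (fun y => S.g y (S.reeb y) (W y)) x :=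
    (contMDiffAt_of_chart (by simp) hkd).mdifferentiableAt one_ne_zero
  have hderiv : mvfderiv (𝓡 (4 * m - 1)) (fun y => S.g y (S.reeb y) (W y)) x (S.reeb x) =
      metric (f u) (-kaehler (cov f N u (ξ u))) (fderiv ℝ f u (η u))
        + metric (f u) (-kaehler (N u)) (cov f (fun z => fderiv ℝ f z (η z)) u (ξ u)) := by
    rw [mvfderiv_eq_fderiv_chart hkm, ← chartField_self, hk.fderiv_eq,
      fderiv_metric hf1 (S.regular_chartFun _) hb hV, hcb]
  have hbracket : S.diff x (VectorField.mlieBracket (𝓡 (4 * m - 1)) S.reeb W x) =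
      fderiv ℝ f u (VectorField.lieBracket ℝ ξ η u) :=
    mvfderiv_mlieBracket (S.mdifferentiableAt_coord x)
  have hconst : (fun y => S.g y (S.reeb y) (S.reeb y)) = fun _ => (1 : ℝ) := funext fun y => by
    rw [g, S.diff_reeb hm, ambient, metric_neg_left, metric_neg_right, neg_neg, metric_kaehler]
    exact S.normal_unit y
  -- As `g(ξ, ξ) = 1` and `[ξ, ξ] = 0`, the Koszul formula collapses to `ξ g(ξ, W) = g([ξ, W], ξ)`.
  have K := hS x W hW
  have hg0 : ∀ Y, S.g x 0 Y = 0 := fun Y => by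
    rw [g, map_zero]; exact metric_zero_left _ _
  rw [hg0, koszul, hconst, hderiv, VectorField.mlieBracket_self, mvfderiv_const] at K
  have e0 : S.g x ((0 : Π y : M, TangentSpace (𝓡 (4 * m - 1)) y) x) (W x) = 0 := hg0 _
  rw [e0, g, hbracket, S.diff_reeb hm, hbr, hcb, ambient, ← S.chartFun_self,
    ← S.chartNormal_self] at K
  have hηu : η u = chartMap x x X := by rw [← hWx]; exact chartField_self W
  have hξu : ξ u = chartMap x x (S.reeb x) := chartField_self S.reeb
  have hz : metric (f u) (cov f N u (η u)) (N u) = 0 := by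
    rw [hηu, ← S.ambientCov_eq_cov, hf, hN, S.chartFun_self, S.chartNormal_self]
    exact S.metric_ambientCov_normal x X
  rw [← S.chartFun_self, S.ambientCov_eq_cov, S.diff_eq_fderiv, ← hξu, ← hηu]
  change metric (f u) (kaehler (fderiv ℝ f u (η u))) (cov f N u (ξ u)) = 0
  -- The bracket is written as `∇̄_ξ W - ∇̄_W ξ`. The `∇̄_ξ W` terms cancel, and `g(∇̄_W ξ, ξ) =
  -- g(∇̄_W N, N) = 0` because `ξ = -JN` with `J` parallel and isometric; `g(J ∇̄_ξ N, W) = 0`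
  -- remains.
  have K' : 0 = metric (f u) (-kaehler (cov f N u (ξ u))) (fderiv ℝ f u (η u))
        + metric (f u) (-kaehler (N u)) (cov f (fun z => fderiv ℝ f z (η z)) u (ξ u))
      - metric (f u) (cov f (fun z => fderiv ℝ f z (η z)) u (ξ u)
          - -kaehler (cov f N u (η u))) (-kaehler (N u)) := by
    simp only [zero_apply] at K
    linarith [K]
  rw [metric_sub_left, metric_neg_left _ (kaehler (cov f N u (η u))),
    metric_neg_right _ (kaehler (cov f N u (η u))), metric_kaehler, hz,
    metric_comm _ (-kaehler (N u)), metric_neg_left _ (kaehler (cov f N u (ξ u)))] at K'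
  rw [metric_kaehler_left, metric_comm]
  linarith

/-- The principal curvature `α = g(Aξ, ξ)` of the Reeb field. -/
def reebCurvature (x : M) : ℝ :=
  metric (coord (S.toFun x)) (S.ambientCov S.normal x (S.reeb x)) (kaehler (S.normal x))

/-- The ambient tangent space is `J(TM) ⊕ ℝ JN`, and `∇̄_ξ N` is orthogonal to the first summand. -/
lemma ambientCov_reeb (hm : 0 < m) (hS : S.GeodesicReebFlow) (x : M) :
    S.ambientCov S.normal x (S.reeb x) = S.reebCurvature x • kaehler (S.normal x) := by
  apply eq_of_metric_eq (S.toFun x)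
  intro U
  have hU : U = kaehler (-kaehler U) := by rw [map_neg, kaehler_kaehler, neg_neg]
  have h := S.diff_tangential hm x (-kaehler U)
  rw [eq_sub_iff_add_eq] at h
  rw [hU, ← h, map_add, map_smul, metric_add_right, metric_add_right, metric_smul_right,
    metric_smul_right, metric_comm _ _ (kaehler (S.diff x _)),
    S.metric_kaehler_ambientCov_reeb hm hS, metric_smul_left, metric_smul_left, metric_kaehler,
    metric_kaehler, metric_comm _ (S.normal x) (S.diff x _), S.metric_diff_normal,
    S.normal_unit, reebCurvature]
  ring

lemma shape_reeb (hm : 0 < m) (hS : S.GeodesicReebFlow) (x : M) :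
    S.shape x (S.reeb x) = S.reebCurvature x • S.reeb x := by
  apply S.diff_injective x
  rw [S.diff_shape hm, map_smul, S.ambientCov_reeb hm hS, S.diff_reeb hm, smul_neg]

/-- Self-adjointness of `A` upgrades `A ξ = α ξ` to the one-form identity `g(A X, ξ) = α η(X)`,
which can be differentiated. -/
lemma metric_ambientCov_kaehler (hm : 0 < m) (hS : S.GeodesicReebFlow) (x : M)
    (X : TangentSpace (𝓡 (4 * m - 1)) x) :
    metric (coord (S.toFun x)) (S.ambientCov S.normal x X) (kaehler (S.normal x)) =
      S.reebCurvature x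
        * -metric (coord (S.toFun x)) (S.diff x X) (kaehler (S.normal x)) := by
  have h := S.metric_diff_ambientCov_comm x (S.reeb x) X
  rw [S.diff_reeb hm, S.ambientCov_reeb hm hS, metric_neg_left, metric_smul_right,
    metric_comm] at h
  linarith

lemma metric_cov_kaehler (hm : 0 < m) (hS : S.GeodesicReebFlow) {x : M}
    {u : EuclideanSpace ℝ (Fin (4 * m - 1))} (hu : u ∈ (extChartAt (𝓡 (4 * m - 1)) x).target)
    (w : EuclideanSpace ℝ (Fin (4 * m - 1))) :
    metric (S.chartFun x u) (cov (S.chartFun x) (S.chartNormal x) u w)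
        (kaehler (S.chartNormal x u)) =
      S.reebCurvature ((extChartAt (𝓡 (4 * m - 1)) x).symm u)
        * -metric (S.chartFun x u) (fderiv ℝ (S.chartFun x) u w)
          (kaehler (S.chartNormal x u)) := by
  rw [← S.ambientCov_chartDeriv hu, ← S.diff_chartDeriv hu]
  exact S.metric_ambientCov_kaehler hm hS _ _

/-- Near `x`, `α` is the quotient `g(A w, ξ) / η(w)` for a constant coordinate vector `w` that
equals `ξ` at the centre, where the denominator is `1`. Both functions are visibly smooth, and no
smoothness of `ξ` is required. -/
lemma contDiffAt_reebCurvature (hm : 0 < m) (hS : S.GeodesicReebFlow) (x : M) :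
    ContDiffAt ℝ ∞ (fun z => S.reebCurvature ((extChartAt (𝓡 (4 * m - 1)) x).symm z))
      (extChartAt (𝓡 (4 * m - 1)) x x) := by
  have hu := mem_extChartAt_target (I := 𝓡 (4 * m - 1)) x
  have hf := S.contDiffAt_chartFun hu
  have hN := S.contDiffAt_chartNormal hu
  have hJ : ContDiffAt ℝ ∞ (fun z => kaehler (S.chartNormal x z))
    (extChartAt (𝓡 (4 * m - 1)) x x) := hN.const_smul Complex.I
  set w := chartMap x x (S.reeb x)
  have hη : ContDiffAt ℝ ∞ (fun z => -metric (S.chartFun x z) (fderiv ℝ (S.chartFun x) z w)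
      (kaehler (S.chartNormal x z))) (extChartAt (𝓡 (4 * m - 1)) x x) :=
    (contDiffAt_metric hf (S.regular_chartFun _)
      ((hf.fderiv_right (m := ∞) (by simp)).clm_apply contDiffAt_const) hJ).neg
  have hω : ContDiffAt ℝ ∞ (fun z => metric (S.chartFun x z)
      (cov (S.chartFun x) (S.chartNormal x) z w) (kaehler (S.chartNormal x z)))
      (extChartAt (𝓡 (4 * m - 1)) x x) :=
    contDiffAt_metric hf (S.regular_chartFun _)
      (contDiffAt_cov (by simp) hf (S.regular_chartFun _) hN w) hJ
  have h1 : -metric (S.chartFun x (extChartAt (𝓡 (4 * m - 1)) x x))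
      (fderiv ℝ (S.chartFun x) (extChartAt (𝓡 (4 * m - 1)) x x) w)
      (kaehler (S.chartNormal x (extChartAt (𝓡 (4 * m - 1)) x x))) ≠ 0 := by
    rw [← S.diff_eq_fderiv, S.chartFun_self, S.chartNormal_self, S.diff_reeb hm,
      metric_neg_left, metric_kaehler, S.normal_unit]
    norm_num
  refine (hω.div hη h1).congr_of_eventuallyEq ?_
  filter_upwards [extChartAt_target_mem_nhds (I := 𝓡 (4 * m - 1)) x,
    hη.continuousAt.eventually_ne h1] with z hz hne
  rw [Pi.div_apply, S.metric_cov_kaehler hm hS hz, mul_div_cancel_right₀ _ hne]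

/-! ### The exterior derivative of the Reeb identity and the elimination of `dα` -/

/-- The exterior derivative of `g(A X, ξ) = α η(X)` on the hypersurface. -/
lemma exterior_derivative_reeb (hm : 0 < m) (hS : S.GeodesicReebFlow) (x : M) :
    ∃ a : TangentSpace (𝓡 (4 * m - 1)) x → ℝ, ∀ X Y,
      metric (coord (S.toFun x)) (curv (coord (S.toFun x)) (S.diff x X) (S.diff x Y) (S.normal x))
          (kaehler (S.normal x))
        + 2 * metric (coord (S.toFun x)) (S.ambientCov S.normal x Y)
          (kaehler (S.ambientCov S.normal x X)) =
      a X * metric (coord (S.toFun x)) (kaehler (S.diff x Y)) (S.normal x)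
        - a Y * metric (coord (S.toFun x)) (kaehler (S.diff x X)) (S.normal x)
        - S.reebCurvature x
          * (metric (coord (S.toFun x)) (kaehler (S.diff x X)) (S.ambientCov S.normal x Y)
            + metric (coord (S.toFun x)) (S.diff x Y) (kaehler (S.ambientCov S.normal x X))) := by
  have hu := mem_extChartAt_target (I := 𝓡 (4 * m - 1)) x
  have h2 : (2 : WithTop ℕ∞) ≤ ∞ := WithTop.coe_le_coe.2 le_top
  -- The witness is `dα` read in the chart. Its existence is all that is needed, since it is
  -- eliminated afterwards.
  refine ⟨fun X => fderiv ℝ (fun z => S.reebCurvature ((extChartAt (𝓡 (4 * m - 1)) x).symm z))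
    (extChartAt (𝓡 (4 * m - 1)) x x) (chartMap x x X), fun X Y => ?_⟩
  have h := exterior_derivative ((S.contDiffAt_chartFun hu).of_le h2) (S.regular_chartFun _)
    ((S.contDiffAt_chartNormal hu).of_le h2)
    ((S.contDiffAt_reebCurvature hm hS x).differentiableAt (by simp))
    (by filter_upwards [extChartAt_target_mem_nhds (I := 𝓡 (4 * m - 1)) x] with z hz
        exact S.metric_cov_kaehler hm hS hz) (chartMap x x X) (chartMap x x Y)
  simp only [← S.diff_eq_fderiv, ← S.ambientCov_eq_cov, S.chartFun_self, S.chartNormal_self,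
    extChartAt_to_inv] at h
  rw [h, metric_kaehler_left _ (S.diff x Y), metric_kaehler_left _ (S.diff x X),
    metric_kaehler_left _ (S.diff x X)]
  ring

/-- The differential of the Reeb principal curvature is determined by the curvature. -/
lemma exterior_derivative_eq (hm : 0 < m) (hS : S.GeodesicReebFlow) (x : M)
    (X Y : TangentSpace (𝓡 (4 * m - 1)) x) :
    2 * metric (coord (S.toFun x)) (S.ambientCov S.normal x Y)
          (kaehler (S.ambientCov S.normal x X))
        + S.reebCurvature x
          * (metric (coord (S.toFun x)) (kaehler (S.diff x X)) (S.ambientCov S.normal x Y)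
            + metric (coord (S.toFun x)) (S.diff x Y) (kaehler (S.ambientCov S.normal x X))) =
      - metric (coord (S.toFun x)) (curv (coord (S.toFun x)) (S.diff x X) (S.diff x Y)
          (S.normal x)) (kaehler (S.normal x))
        + metric (coord (S.toFun x)) (kaehler (S.diff x X)) (S.normal x)
          * metric (coord (S.toFun x)) (curv (coord (S.toFun x)) (-kaehler (S.normal x))
            (S.diff x Y) (S.normal x)) (kaehler (S.normal x))
        - metric (coord (S.toFun x)) (kaehler (S.diff x Y)) (S.normal x)
          * metric (coord (S.toFun x)) (curv (coord (S.toFun x)) (-kaehler (S.normal x))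
            (S.diff x X) (S.normal x)) (kaehler (S.normal x)) := by
  obtain ⟨a, ha⟩ := S.exterior_derivative_reeb hm hS x
  -- For `X = ξ` every term with the shape operator vanishes, since `J ∇̄_ξ N = -α N` and `∇̄_Y N`
  -- is tangent. This solves for `dα(Y)`; the products `dα(ξ) η(X) η(Y)` cancel in the final
  -- substitution.
  have key : ∀ Y, metric (coord (S.toFun x)) (curv (coord (S.toFun x)) (-kaehler (S.normal x))
      (S.diff x Y) (S.normal x)) (kaehler (S.normal x)) =
      a (S.reeb x) * metric (coord (S.toFun x)) (kaehler (S.diff x Y)) (S.normal x) - a Y := by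
    intro Y
    have h := ha (S.reeb x) Y
    rw [S.ambientCov_reeb hm hS, S.diff_reeb hm, map_smul, kaehler_kaehler, map_neg,
      kaehler_kaehler, neg_neg, metric_smul_right, metric_neg_right, metric_smul_right,
      metric_neg_right, S.metric_ambientCov_normal, S.metric_diff_normal, S.normal_unit,
      metric_comm _ (S.normal x) (S.ambientCov _ _ _), S.metric_ambientCov_normal] at h
    linarith
  rw [key, key]
  linarith [ha X Y]

end OrientedHypersurface

end HyperbolicGrassmannian
end

/-! ### The main theorem -/

theorem proposition2p1 (m : ℕ) (hm : 2 ≤ m) {M : Type*} [TopologicalSpace M] [ConnectedSpace M]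
    [ChartedSpace (EuclideanSpace ℝ (Fin (4 * m - 1))) M] [IsManifold (𝓡 (4 * m - 1)) ∞ M]
    (S : HyperbolicGrassmannian.OrientedHypersurface m M) (hS : S.GeodesicReebFlow) :
    ∃ α : M → ℝ, ContMDiff (𝓡 (4 * m - 1)) 𝓘(ℝ, ℝ) ∞ α ∧
      (∀ x, S.shape x (S.reeb x) = α x • S.reeb x) ∧
      ∀ (x : M) (Jq : Fin 3 → HyperbolicGrassmannian.Coord m →ₗ[ℝ] HyperbolicGrassmannian.Coord m),
        HyperbolicGrassmannian.IsCanonicalBasis (S.toFun x) Jq →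
        ∀ X Y : TangentSpace (𝓡 (4 * m - 1)) x,
          2 * S.g x (S.shape x (S.φ x (S.shape x X))) Y
              - α x * S.g x (S.shape x (S.φ x X) + S.φ x (S.shape x X)) Y + S.g x (S.φ x X) Y =
            ∑ ν : Fin 3,
              (S.eta x (Jq ν) X * S.eta x (Jq ν) (S.φ x Y)
                - S.eta x (Jq ν) Y * S.eta x (Jq ν) (S.φ x X)
                - S.g x (S.phi x (Jq ν) X) Y * S.eta x (Jq ν) (S.reeb x)
                - 2 * S.η x X * S.eta x (Jq ν) (S.φ x Y) * S.eta x (Jq ν) (S.reeb x)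
                + 2 * S.η x Y * S.eta x (Jq ν) (S.φ x X) * S.eta x (Jq ν) (S.reeb x)) := by
  have hm0 : 0 < m := by omega
  refine ⟨S.reebCurvature, fun x => HyperbolicGrassmannian.contMDiffAt_of_chart le_rfl
    (S.contDiffAt_reebCurvature hm0 hS x), S.shape_reeb hm0 hS, fun x Jq hJ X Y => ?_⟩
  open HyperbolicGrassmannian in
  have hsum := sum_canonicalBasis hm0 hJ rfl (S.normal_unit x) (S.metric_diff_normal x X)
    (S.metric_diff_normal x Y)
  have hext := S.exterior_derivative_eq hm0 hS x X Y
  -- Self-adjointness moves the outer `A` onto `Y`, so the left-hand side involves only `∇̄_X N` and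
  -- `∇̄_Y N`, as `hext` does.
  have hshape : ∀ Z, S.g x (S.shape x Z) Y =
      -metric (coord (S.toFun x)) (S.diff x Z) (S.ambientCov S.normal x Y) := fun Z => by
    rw [OrientedHypersurface.g, S.diff_shape hm0, OrientedHypersurface.ambient, metric_neg_left,
      metric_comm, S.metric_diff_ambientCov_comm]
  have hphi : ∀ T Z, S.g x (S.phi x T Z) Y = metric (coord (S.toFun x)) (T (S.diff x Z))
      (S.diff x Y) := fun T Z => by
    rw [OrientedHypersurface.g, S.diff_phi hm0, OrientedHypersurface.ambient, metric_sub_left,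
      metric_smul_left, metric_comm _ (S.normal x), S.metric_diff_normal]
    ring
  have hadd : ∀ Z Z', S.g x (Z + Z') Y = S.g x Z Y + S.g x Z' Y := fun Z Z' => by
    rw [OrientedHypersurface.g, map_add, OrientedHypersurface.ambient, metric_add_left]
    rfl
  -- This discards the normal corrections by which `φ` differs from `J` when paired with `∇̄_Y N`.
  have hN : metric (coord (S.toFun x)) (S.normal x) (S.ambientCov S.normal x Y) = 0 := by
    rw [metric_comm, S.metric_ambientCov_normal]
  simp only [OrientedHypersurface.φ, OrientedHypersurface.η, hadd, hshape, hphi,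
    OrientedHypersurface.eta, OrientedHypersurface.ambient, S.diff_phi hm0, S.diff_shape hm0,
    S.diff_reeb hm0]
  rw [hsum]
  simp only [metric_sub_left, metric_smul_left, hN, map_neg, metric_neg_left]
  rw [metric_comm _ (kaehler (S.ambientCov S.normal x X)) (S.ambientCov S.normal x Y),
    metric_comm _ (kaehler (S.ambientCov S.normal x X)) (S.diff x Y)]
  linear_combination hext
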